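/- Write $\mathrm{Z}^*$ for Zermelo set theory (without choice) together with the axiom that the universe is the union of the von Neumann hierarchy (every set belongs to $V_\alpha$ for some ordinal $\alpha$). For an ordinal $\delta$, $\mathrm{DC}_\delta$ asserts: for every nonempty set $S$ and every binary relation $R$, if for each sequence $s\in S^{<\delta}$ there is $y\in S$ with $s\mathrel{R}y$, then there is a function $f:\delta\to S$ such that $f\upharpoonright\alpha\mathrel{R}f(\alpha)$ for each $\alpha<\delta$. For a transitive model $M$, $P(\delta)^M$ denotes the collection of subsets of $\delta$ that lie in $M$, and $H_{\delta^+}^M$ the collection of sets $x\in M$ of hereditary size at most $\delta$ in $M$ (the transitive closure of $x$ has, in $M$, an injection into $\delta$). A set $A$ is said to have size less than $\delta$ in $M$, written $|A|^M<\delta$, if some injection from $A$ into an ordinal $\alpha<\delta$ lies in $M$. Let $V\subseteq W$ be transitive models and let $\delta$ be a cardinal in $W$. The pair $V\subseteq W$ has the $\delta$-cover property if for every $A\in W$ with $A\subseteq V$ and $|A|^W<\delta$ there is $B\in V$ with $A\subseteq B$ and $|B|^V<\delta$. It has the $\delta$-approximation property if whenever $A\in W$, $A\subseteq V$, and $A\cap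 a\in V$ for every $a\in V$ with $|a|^V<\delta$, then $A\in V$. Theorem. Suppose that $V$, $V'$ and $W$ are transitive models (sets or classes) of $\mathrm{Z}^*+\mathrm{DC}_\delta$, where $\delta$ is an infinite regular cardinal of $W$ that belongs to all three models. Suppose that $V\subseteq W$ and $V'\subseteq W$, that both pairs have the $\delta$-cover and the $\delta$-approximation properties, that $P(\delta)^V=P(\delta)^{V'}$, and that $H_{\delta^+}^W\cap V=H_{\delta^+}^V$. Then $V=V'$. -/

import Mathlib

universe u

namespace SetModel

/-! Classes are arbitrary `M : Set ZFSet`, so set-sized and class-sized transitive models are both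
covered. An axiom holds in `M` when its relativization to `M` holds; the notions "ordered pair",
"function", "ordinal" and "subset" are written unrelativized, since they are absolute for
transitive `M`. -/

/-- The only symbol of the language of set theory is the binary relation symbol for membership. -/
inductive MemRel : ℕ → Type
  | mem : MemRel 2

/-- The first-order language of set theory. -/
def setLanguage : FirstOrder.Language.{0, 0} := ⟨fun _ => Empty, MemRel⟩

/-- Every class `M` of sets is a structure `⟨M, ∈⟩` for the language of set theory. -/
instance memStructure (M : Set ZFSet.{u}) : setLanguage.Structure M where
  funMap := fun f => f.elim
  RelMap := fun {_} r =>
    match r with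
    | MemRel.mem => fun x => (x 0 : ZFSet.{u}) ∈ (x 1 : ZFSet.{u})

/-- `M` is a transitive class. -/
def IsTransitiveClass (M : Set ZFSet.{u}) : Prop :=
  ∀ x ∈ M, ∀ y ∈ x, y ∈ M

/-- `h` is, in the sense of `M`, the von Neumann hierarchy `⟨V_β | β ≤ α⟩`: a function with domain
`α + 1 = α ∪ {α}` such that `h(β) = ⋃_{γ < β} P(h(γ))` for all `β ≤ α`, with power sets computed
in `M`. -/
def IsVonNeumannHierarchy (M : Set ZFSet.{u}) (α h : ZFSet.{u}) : Prop :=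
  (∃ Y ∈ M, ZFSet.IsFunc (insert α α) Y h) ∧
    ∀ β v, ZFSet.pair β v ∈ h →
      ∀ z ∈ M, (z ∈ v ↔ ∃ γ ∈ β, ∃ w, ZFSet.pair γ w ∈ h ∧ z ⊆ w)

/-- `M` satisfies `Z*`: Zermelo set theory without choice, together with the axiom that the
universe is the union of the von Neumann hierarchy. -/
structure ModelsZStar (M : Set ZFSet.{u}) : Prop where
  extensionality : ∀ x ∈ M, ∀ y ∈ M, (∀ z ∈ M, (z ∈ x ↔ z ∈ y)) → x = y
  foundation : ∀ x ∈ M, (∃ y ∈ M, y ∈ x) → ∃ y ∈ M, y ∈ x ∧ ∀ z ∈ M, z ∈ y → z ∉ x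
  pairing : ∀ x ∈ M, ∀ y ∈ M, ∃ p ∈ M, ∀ z ∈ M, (z ∈ p ↔ z = x ∨ z = y)
  union : ∀ x ∈ M, ∃ s ∈ M, ∀ z ∈ M, (z ∈ s ↔ ∃ y ∈ M, y ∈ x ∧ z ∈ y)
  powerset : ∀ x ∈ M, ∃ p ∈ M, ∀ z ∈ M, (z ∈ p ↔ z ⊆ x)
  infinity : ∃ w ∈ M, ∅ ∈ w ∧ ∀ n ∈ w, insert n n ∈ w
  /-- The separation scheme: `D` ranges over the subclasses of `M` that are first-order definable
  over `⟨M, ∈⟩` with parameters from `M`. -/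
  separation : ∀ D : Set M, (Set.univ : Set M).Definable₁ setLanguage D →
    ∀ a ∈ M, ∃ b ∈ M, ∀ z : M, ((z : ZFSet.{u}) ∈ b ↔ (z : ZFSet.{u}) ∈ a ∧ z ∈ D)
  /-- Every set is an element of some `V_α`. -/
  vonNeumann : ∀ x ∈ M, ∃ α ∈ M, α.IsOrdinal ∧
    ∃ h ∈ M, IsVonNeumannHierarchy M α h ∧ ∃ v ∈ M, ZFSet.pair α v ∈ h ∧ x ∈ v

/-- The restriction `f ↾ a` of a function (as a set of ordered pairs). -/
noncomputable def restrict (f a : ZFSet.{u}) : ZFSet.{u} :=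
  ZFSet.sep (fun p => ∃ ξ ∈ a, ∃ y, p = ZFSet.pair ξ y) f

/-- `M` satisfies Lévy's `DC_δ` (which presupposes `δ ∈ M`): for every nonempty set `S` and every
binary relation `R`, if each `s ∈ S^{<δ}` is `R`-related to some `y ∈ S`, then there is
`f : δ → S` such that `f ↾ α` is `R`-related to `f(α)` for each `α < δ`. -/
def ModelsDC (M : Set ZFSet.{u}) (δ : ZFSet.{u}) : Prop :=
  δ ∈ M ∧ ∀ S ∈ M, S.Nonempty → ∀ R ∈ M,
    (∀ s ∈ M, (∃ α ∈ δ, ZFSet.IsFunc α S s) → ∃ y ∈ S, ZFSet.pair s y ∈ R) →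
      ∃ f ∈ M, ZFSet.IsFunc δ S f ∧
        ∀ α ∈ δ, ∃ y, ZFSet.pair α y ∈ f ∧ ZFSet.pair (restrict f α) y ∈ R

/-- `|A|^M ≤ |B|^M`: some injection from `A` to `B` belongs to `M`. -/
def SizeLE (M : Set ZFSet.{u}) (A B : ZFSet.{u}) : Prop :=
  ∃ f ∈ M, ZFSet.IsFunc A B f ∧
    ∀ x y z, ZFSet.pair x z ∈ f → ZFSet.pair y z ∈ f → x = y

/-- `|A|^M < δ`, for `δ` a cardinal of `M`: the size of `A` in `M` is at most that of some ordinal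
`α < δ`. -/
def SizeLT (M : Set ZFSet.{u}) (A δ : ZFSet.{u}) : Prop :=
  ∃ α ∈ δ, SizeLE M A α

/-- `δ` is an (infinite) regular cardinal in the sense of `M`: an infinite ordinal of `M` such that
no function in `M` maps a smaller ordinal cofinally into `δ`. -/
def IsRegularIn (M : Set ZFSet.{u}) (δ : ZFSet.{u}) : Prop :=
  δ ∈ M ∧ δ.IsOrdinal ∧ ZFSet.omega ⊆ δ ∧
    ∀ α ∈ δ, ∀ f ∈ M, ZFSet.IsFunc α δ f →
      ¬ ∀ β ∈ δ, ∃ ξ γ, ZFSet.pair ξ γ ∈ f ∧ β ⊆ γ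

/-- The `δ`-cover property of the pair `V ⊆ W`. -/
def CoverProperty (V W : Set ZFSet.{u}) (δ : ZFSet.{u}) : Prop :=
  ∀ A ∈ W, (∀ x ∈ A, x ∈ V) → SizeLT W A δ → ∃ B ∈ V, A ⊆ B ∧ SizeLT V B δ

/-- The `δ`-approximation property of the pair `V ⊆ W`. -/
def ApproximationProperty (V W : Set ZFSet.{u}) (δ : ZFSet.{u}) : Prop :=
  ∀ A ∈ W, (∀ x ∈ A, x ∈ V) → (∀ a ∈ V, SizeLT V a δ → A ∩ a ∈ V) → A ∈ V

/-- `P(a)^M`, the collection of all subsets of `a` that belong to `M`. -/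
def powersetIn (M : Set ZFSet.{u}) (a : ZFSet.{u}) : Set ZFSet.{u} :=
  {x | x ∈ M ∧ x ⊆ a}

/-- `H_{δ⁺}^M`, the collection of all sets in `M` of hereditary size at most `δ` in `M`, that is,
whose transitive closure has size at most `δ` in `M`; equivalently, which are included in some
transitive set of size at most `δ` in `M`. -/
def hereditarilySizeLE (M : Set ZFSet.{u}) (δ : ZFSet.{u}) : Set ZFSet.{u} :=
  {x | x ∈ M ∧ ∃ T ∈ M, T.IsTransitive ∧ x ⊆ T ∧ SizeLE M T δ}

end SetModel

/-!
Why `V = V'`. By induction on rank, let `V` and `V'` agree on all sets of rank less than `o`, and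
let `x` be a set of rank `o` in one of them. Since the universe of each model is the union of its
von Neumann hierarchy, the common part `U` of `V` and `V'` below rank `o` is a set in both
(`exists_level`, `level_mem`), and `x ⊆ U`. It remains to see that `V` and `V'` have the same
subsets of `U`.

By approximation and cover this is a question about small subsets `A` of `U`, where small means of
size less than `δ` in `W`. In `W`, `DC_δ` builds an increasing chain of length `δ` of small subsets
of `U`, starting from `A`, that passes through members of `V` and members of `V'` cofinally and
whose union `B` is extensional (`exists_hull`). As `δ` is regular, a small set meets `B` inside one
stage, so approximation puts `B` into both `V` and `V'`. The transitive collapse `T` of `B` lies in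
`V` and has size at most `δ` in `W`, so the hypothesis on `H_{δ⁺}` gives an injection of `T` into
`δ` in `V`. Membership on `T` is then coded by a subset of `δ`, which also lies in `V'`; decoding it
there and collapsing recovers the same injection of `B` into `δ` in `V'`
(`exists_common_injection`). Along it, subsets of `B` become subsets of `δ`, and these are the same
in `V` and in `V'` (`mem_of_subset_of_forall_exists_injection`).

There is no replacement scheme, so every set must be obtained by separation from a set given
beforehand. Recursion is needed only for collapses of well-founded relations with values in a given
set (`exists_collapse_mem`). This covers the collapse of `B`, and also Gödel's pairing function on
`δ` (`godelPairing`), whose values stay below `δ` because `δ` is regular. Collapses are defined in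
the ambient universe, so that those computed in different models agree automatically.

Definability, required by the separation scheme, is established by instance search: the classes
`DefPred` and `DefFun` are closed under the connectives, the quantifiers over `M` and over elements
of `M`, and the basic set operations; parameters `c` enter through instances of `Fact (c ∈ M)`.
-/

namespace SetModel

open FirstOrder

/-! ### A calculus of definable predicates -/

/-- A predicate of finitely many elements of `M` is definable when it is first-order definable with
parameters over `⟨M, ∈⟩`. -/
class DefPred (M : Set ZFSet.{u}) {ι : Type} (P : (ι → M) → Prop) : Prop where
  definable : (Set.univ : Set M).Definable setLanguage {v | P v}

/-- A function from finite tuples of elements of `M` to sets is definable when its values lie in `M`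
and its graph is definable. -/
class DefFun (M : Set ZFSet.{u}) {ι : Type} (f : (ι → M) → ZFSet.{u}) : Prop where
  mem : ∀ v, f v ∈ M
  graph : DefPred M fun w : ι ⊕ Fin 1 → M => (w (.inr 0) : ZFSet.{u}) = f fun i => w (.inl i)

/-- A transitive class satisfying `Z*`. -/
class TransModel (M : Set ZFSet.{u}) : Prop where
  trans : IsTransitiveClass M
  zstar : ModelsZStar M

section Calculus

variable {M : Set ZFSet.{u}} {ι κ : Type}

theorem DefPred.of_iff {P Q : (ι → M) → Prop} (h : DefPred M Q) (e : ∀ v, P v ↔ Q v) :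
    DefPred M P := by
  have : P = Q := funext fun v => propext (e v)
  rwa [this]

theorem DefPred.reindex {P : (ι → M) → Prop} (h : DefPred M P) (σ : ι → κ) :
    DefPred M fun w : κ → M => P fun i => w (σ i) :=
  ⟨h.definable.preimage_comp σ⟩

instance DefPred.and {P Q : (ι → M) → Prop} [hP : DefPred M P] [hQ : DefPred M Q] :
    DefPred M fun v => P v ∧ Q v :=
  ⟨hP.definable.inter hQ.definable⟩

instance DefPred.or {P Q : (ι → M) → Prop} [hP : DefPred M P] [hQ : DefPred M Q] :
    DefPred M fun v => P v ∨ Q v :=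
  ⟨hP.definable.union hQ.definable⟩

instance DefPred.not {P : (ι → M) → Prop} [hP : DefPred M P] : DefPred M fun v => ¬ P v :=
  ⟨hP.definable.compl⟩

instance DefPred.imp {P Q : (ι → M) → Prop} [DefPred M P] [DefPred M Q] :
    DefPred M fun v => P v → Q v :=
  DefPred.of_iff (inferInstanceAs (DefPred M fun v => ¬ P v ∨ Q v)) fun _ => imp_iff_not_or

instance DefPred.iff {P Q : (ι → M) → Prop} [DefPred M P] [DefPred M Q] :
    DefPred M fun v => P v ↔ Q v :=
  DefPred.of_iff (inferInstanceAs (DefPred M fun v => (P v → Q v) ∧ (Q v → P v)))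
    fun _ => iff_iff_implies_and_implies

instance DefPred.exists_mem_class {P : (ι → M) → ZFSet.{u} → Prop}
    [h : DefPred M fun w : ι ⊕ Fin 1 → M => P (fun i => w (.inl i)) (w (.inr 0))] :
    DefPred M fun v => ∃ y, y ∈ M ∧ P v y := by
  refine ⟨?_⟩
  convert h.definable.image_comp_sumInl_fin 1 using 1
  ext v
  simp only [Set.mem_ofPred_eq, Set.mem_image]
  constructor
  · rintro ⟨y, hy, hP⟩
    exact ⟨Sum.elim v fun _ => ⟨y, hy⟩, by simpa using hP, by ext; simp⟩
  · rintro ⟨w, hw, rfl⟩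
    exact ⟨_, (w (.inr 0)).2, hw⟩

instance DefPred.forall_mem_class {P : (ι → M) → ZFSet.{u} → Prop}
    [h : DefPred M fun w : ι ⊕ Fin 1 → M => P (fun i => w (.inl i)) (w (.inr 0))] :
    DefPred M fun v => ∀ y, y ∈ M → P v y :=
  by
  have : DefPred M fun v => ¬ ∃ y, y ∈ M ∧ ¬ P v y := inferInstance
  exact this.of_iff fun _ => by push Not; rfl

theorem DefPred.mem_var (i j : ι) :
    DefPred M fun v : ι → M => (v i : ZFSet.{u}) ∈ (v j : ZFSet.{u}) := by
  refine ⟨Set.Definable.mono (A := ∅) ?_ (Set.empty_subset _)⟩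
  rw [Set.empty_definable_iff]
  refine ⟨Language.Relations.formula₂ (L := setLanguage) (MemRel.mem : setLanguage.Relations 2)
    (Language.Term.var i) (Language.Term.var j), ?_⟩
  ext v
  exact Iff.rfl

theorem DefPred.eq_var (i j : ι) :
    DefPred M fun v : ι → M => (v i : ZFSet.{u}) = (v j : ZFSet.{u}) := by
  refine ⟨Set.Definable.mono (A := ∅) ?_ (Set.empty_subset _)⟩
  rw [Set.empty_definable_iff]
  refine ⟨Language.Term.equal (L := setLanguage)
    (Language.Term.var i) (Language.Term.var j), ?_⟩
  ext v
  simp [Language.Formula.realize_equal, Subtype.ext_iff]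

instance DefFun.var (i : ι) : DefFun M fun v : ι → M => (v i : ZFSet.{u}) :=
  ⟨fun v => (v i).2, DefPred.eq_var _ _⟩

instance DefFun.const (c : ZFSet.{u}) [hc : Fact (c ∈ M)] : DefFun M fun _ : ι → M => c := by
  refine ⟨fun _ => hc.out, ⟨?_⟩⟩
  refine ⟨Language.Term.equal (Language.Term.var (.inr 0))
    (Language.Constants.term
      ((setLanguage.con (⟨⟨c, hc.out⟩, Set.mem_univ _⟩ : (Set.univ : Set M))))), ?_⟩
  ext v
  simp [Language.Formula.realize_equal, Subtype.ext_iff]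

/-- Substitution of a definable function into a definable predicate. -/
theorem DefPred.subst {P : (ι → M) → ZFSet.{u} → Prop} {f : (ι → M) → ZFSet.{u}}
    (hf : DefFun M f)
    (h : DefPred M fun w : ι ⊕ Fin 1 → M => P (fun i => w (.inl i)) (w (.inr 0))) :
    DefPred M fun v => P v (f v) := by
  have := hf.graph
  have : DefPred M fun v => ∃ y, y ∈ M ∧ (y = f v ∧ P v y) := inferInstance
  exact this.of_iff fun v => ⟨fun h => ⟨_, hf.mem v, rfl, h⟩, by rintro ⟨_, _, rfl, h⟩; exact h⟩

theorem DefFun.weaken {f : (ι → M) → ZFSet.{u}} (hf : DefFun M f) (σ : ι → κ) :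
    DefFun M fun w : κ → M => f fun i => w (σ i) :=
  ⟨fun _ => hf.mem _, by
    exact hf.graph.reindex (Sum.elim (fun i => .inl (σ i)) .inr : ι ⊕ Fin 1 → κ ⊕ Fin 1)⟩

theorem DefPred.subst₂ {P : ZFSet.{u} → ZFSet.{u} → Prop} {f g : (ι → M) → ZFSet.{u}}
    (hf : DefFun M f) (hg : DefFun M g)
    (h : DefPred M fun w : Fin 2 → M => P (w 0) (w 1)) :
    DefPred M fun v => P (f v) (g v) := by
  refine DefPred.subst (P := fun v y => P y (g v)) hf ?_
  refine DefPred.subst (P := fun (w : ι ⊕ Fin 1 → M) y => P (w (.inr 0)) y)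
    (hg.weaken Sum.inl) ?_
  exact h.reindex (![.inl (.inr 0), .inr 0] : Fin 2 → (ι ⊕ Fin 1) ⊕ Fin 1)

theorem DefFun.comp₂ {F : ZFSet.{u} → ZFSet.{u} → ZFSet.{u}} {f g : (ι → M) → ZFSet.{u}}
    (hf : DefFun M f) (hg : DefFun M g) (hF : ∀ x ∈ M, ∀ y ∈ M, F x y ∈ M)
    (h : DefPred M fun w : Fin 3 → M => (w 2 : ZFSet.{u}) = F (w 0) (w 1)) :
    DefFun M fun v => F (f v) (g v) := by
  refine ⟨fun v => hF _ (hf.mem v) _ (hg.mem v), ?_⟩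
  refine DefPred.subst (P := fun (w : ι ⊕ Fin 1 → M) y => (w (.inr 0) : ZFSet.{u}) = F y _)
    (hf.weaken Sum.inl) ?_
  refine DefPred.subst
    (P := fun (w : (ι ⊕ Fin 1) ⊕ Fin 1 → M) y => (w (.inl (.inr 0)) : ZFSet.{u}) = F (w (.inr 0)) y)
    (hg.weaken fun i => Sum.inl (Sum.inl i)) ?_
  exact h.reindex (![.inl (.inr 0), .inr 0, .inl (.inl (.inr 0))] :
    Fin 3 → ((ι ⊕ Fin 1) ⊕ Fin 1) ⊕ Fin 1)

instance DefPred.mem {f g : (ι → M) → ZFSet.{u}} [hf : DefFun M f] [hg : DefFun M g] :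
    DefPred M fun v => f v ∈ g v :=
  DefPred.subst₂ (P := fun x y => x ∈ y) hf hg (DefPred.mem_var 0 1)

instance DefPred.eq {f g : (ι → M) → ZFSet.{u}} [hf : DefFun M f] [hg : DefFun M g] :
    DefPred M fun v => f v = g v :=
  DefPred.subst₂ (P := fun x y => x = y) hf hg (DefPred.eq_var 0 1)

instance DefPred.ne {f g : (ι → M) → ZFSet.{u}} [hf : DefFun M f] [hg : DefFun M g] :
    DefPred M fun v => f v ≠ g v :=
  inferInstanceAs (DefPred M fun v => ¬ f v = g v)

instance DefPred.exists_mem [hM : TransModel M] {g : (ι → M) → ZFSet.{u}} [hg : DefFun M g]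
    {P : (ι → M) → ZFSet.{u} → Prop}
    [h : DefPred M fun w : ι ⊕ Fin 1 → M => P (fun i => w (.inl i)) (w (.inr 0))] :
    DefPred M fun v => ∃ y, y ∈ g v ∧ P v y := by
  have := hg.weaken (κ := ι ⊕ Fin 1) Sum.inl
  have : DefPred M fun v => ∃ y, y ∈ M ∧ (y ∈ g v ∧ P v y) := inferInstance
  exact this.of_iff fun v => ⟨fun ⟨y, hy, hP⟩ => ⟨y, hM.trans _ (hg.mem v) _ hy, hy, hP⟩,
    fun ⟨y, _, hy, hP⟩ => ⟨y, hy, hP⟩⟩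

instance DefPred.forall_mem [hM : TransModel M] {g : (ι → M) → ZFSet.{u}} [hg : DefFun M g]
    {P : (ι → M) → ZFSet.{u} → Prop}
    [h : DefPred M fun w : ι ⊕ Fin 1 → M => P (fun i => w (.inl i)) (w (.inr 0))] :
    DefPred M fun v => ∀ y, y ∈ g v → P v y :=
  by
  have := hg.weaken (κ := ι ⊕ Fin 1) Sum.inl
  have : DefPred M fun v => ¬ ∃ y, y ∈ g v ∧ ¬ P v y := inferInstance
  exact this.of_iff fun _ => by push Not; rfl

instance DefPred.subset [hM : TransModel M] {f g : (ι → M) → ZFSet.{u}} [hf : DefFun M f]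
    [hg : DefFun M g] : DefPred M fun v => f v ⊆ g v := by
  refine DefPred.subst₂ (P := fun x y => x ⊆ y) hf hg ?_
  have : DefPred M fun w : Fin 2 → M => ∀ y, y ∈ (w 0 : ZFSet.{u}) → y ∈ (w 1 : ZFSet.{u}) :=
    inferInstance
  exact this

end Calculus

/-! ### Closure properties of transitive models -/

section Closure

variable {M : Set ZFSet.{u}} {ι κ : Type} [hM : TransModel M]

theorem mem_of_mem {x y : ZFSet.{u}} (hx : x ∈ M) (h : y ∈ x) : y ∈ M := hM.trans x hx y h

/-- The separation scheme, for definable predicates. -/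
theorem sep_mem {a : ZFSet.{u}} (ha : a ∈ M) (P : ZFSet.{u} → Prop)
    [h : DefPred M fun w : Fin 1 → M => P (w 0)] : ZFSet.sep P a ∈ M := by
  obtain ⟨b, hb, hbz⟩ := hM.zstar.separation {x : M | P x} (by exact h.definable) a ha
  convert hb using 1
  ext z
  rw [ZFSet.mem_sep]
  constructor
  · rintro ⟨hz, hP⟩
    exact (hbz ⟨z, mem_of_mem ha hz⟩).2 ⟨hz, hP⟩
  · intro hz
    exact (hbz ⟨z, mem_of_mem hb hz⟩).1 hz

theorem upair_mem {x y : ZFSet.{u}} (hx : x ∈ M) (hy : y ∈ M) : ({x, y} : ZFSet.{u}) ∈ M := by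
  obtain ⟨p, hp, h⟩ := hM.zstar.pairing x hx y hy
  convert hp using 1
  ext z
  rw [ZFSet.mem_pair]
  refine ⟨fun hz => (h z (by rcases hz with rfl | rfl <;> assumption)).2 hz,
    fun hz => (h z (mem_of_mem hp hz)).1 hz⟩

theorem singleton_mem {x : ZFSet.{u}} (hx : x ∈ M) : ({x} : ZFSet.{u}) ∈ M := by
  rw [← ZFSet.pair_eq_singleton]; exact upair_mem hx hx

theorem pair_mem {x y : ZFSet.{u}} (hx : x ∈ M) (hy : y ∈ M) : ZFSet.pair x y ∈ M :=
  upair_mem (singleton_mem hx) (upair_mem hx hy)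

theorem sUnion_mem {x : ZFSet.{u}} (hx : x ∈ M) : ZFSet.sUnion x ∈ M := by
  obtain ⟨p, hp, h⟩ := hM.zstar.union x hx
  convert hp using 1
  ext z
  rw [ZFSet.mem_sUnion]
  refine ⟨fun ⟨y, hy, hz⟩ => (h z (mem_of_mem (mem_of_mem hx hy) hz)).2
    ⟨y, mem_of_mem hx hy, hy, hz⟩, fun hz => ?_⟩
  obtain ⟨y, _, hy, hz⟩ := (h z (mem_of_mem hp hz)).1 hz
  exact ⟨y, hy, hz⟩

theorem union_mem {x y : ZFSet.{u}} (hx : x ∈ M) (hy : y ∈ M) : x ∪ y ∈ M :=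
  sUnion_mem (upair_mem hx hy)

theorem insert_mem {x y : ZFSet.{u}} (hx : x ∈ M) (hy : y ∈ M) : insert x y ∈ M := by
  rw [ZFSet.insert_eq]; exact union_mem (singleton_mem hx) hy

theorem empty_mem : (∅ : ZFSet.{u}) ∈ M := by
  obtain ⟨w, hw, h, _⟩ := hM.zstar.infinity
  exact mem_of_mem hw h

theorem inter_mem {x y : ZFSet.{u}} (hx : x ∈ M) (hy : y ∈ M) : x ∩ y ∈ M := by
  have := Fact.mk hy
  exact sep_mem hx (fun z => z ∈ y)

variable (M) in
/-- The power set of `x` in the sense of `M`. -/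
noncomputable def pow (x : ZFSet.{u}) : ZFSet.{u} := ZFSet.sep (fun y => y ∈ M) x.powerset

omit hM in
@[simp] theorem mem_pow {x y : ZFSet.{u}} : y ∈ pow M x ↔ y ⊆ x ∧ y ∈ M := by
  simp [pow]

theorem pow_mem {x : ZFSet.{u}} (hx : x ∈ M) : pow M x ∈ M := by
  obtain ⟨p, hp, h⟩ := hM.zstar.powerset x hx
  convert hp using 1
  ext z
  rw [mem_pow]
  exact ⟨fun ⟨h1, h2⟩ => (h z h2).2 h1, fun hz => ⟨(h z (mem_of_mem hp hz)).1 hz, mem_of_mem hp hz⟩⟩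

instance DefFun.empty : DefFun M fun _ : ι → M => (∅ : ZFSet.{u}) :=
  have : Fact ((∅ : ZFSet.{u}) ∈ M) := ⟨empty_mem⟩
  inferInstance

instance DefFun.upair {f g : (ι → M) → ZFSet.{u}} [hf : DefFun M f] [hg : DefFun M g] :
    DefFun M fun v => ({f v, g v} : ZFSet.{u}) := by
  refine DefFun.comp₂ (F := fun x y => {x, y}) hf hg (fun x hx y hy => upair_mem hx hy) ?_
  have : DefPred M fun w : Fin 3 → M => ∀ z, z ∈ M →
    (z ∈ (w 2 : ZFSet.{u}) ↔ z = (w 0 : ZFSet.{u}) ∨ z = (w 1 : ZFSet.{u})) := inferInstance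
  refine this.of_iff fun w => ?_
  constructor
  · rintro h z -
    rw [h, ZFSet.mem_pair]
  · intro h
    ext z
    rw [ZFSet.mem_pair]
    exact ⟨fun hz => (h z (mem_of_mem (w 2).2 hz)).1 hz, fun hz => (h z (by
      rcases hz with rfl | rfl
      exacts [(w 0).2, (w 1).2])).2 hz⟩

instance DefFun.pair {f g : (ι → M) → ZFSet.{u}} [hf : DefFun M f] [hg : DefFun M g] :
    DefFun M fun v => ZFSet.pair (f v) (g v) := by
  have : DefFun M fun v => ({{f v, f v}, {f v, g v}} : ZFSet.{u}) := inferInstance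
  simpa only [ZFSet.pair_eq_singleton, ← ZFSet.pair.eq_1] using this

instance DefFun.union {f g : (ι → M) → ZFSet.{u}} [hf : DefFun M f] [hg : DefFun M g] :
    DefFun M fun v => f v ∪ g v := by
  refine DefFun.comp₂ (F := fun x y => x ∪ y) hf hg (fun x hx y hy => union_mem hx hy) ?_
  have : DefPred M fun w : Fin 3 → M => ∀ z, z ∈ M →
    (z ∈ (w 2 : ZFSet.{u}) ↔ z ∈ (w 0 : ZFSet.{u}) ∨ z ∈ (w 1 : ZFSet.{u})) := inferInstance
  refine this.of_iff fun w => ?_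
  constructor
  · rintro h z -
    rw [h, ZFSet.mem_union]
  · intro h
    ext z
    rw [ZFSet.mem_union]
    exact ⟨fun hz => (h z (mem_of_mem (w 2).2 hz)).1 hz, fun hz => (h z (by
      rcases hz with hz | hz
      exacts [mem_of_mem (w 0).2 hz, mem_of_mem (w 1).2 hz])).2 hz⟩

instance DefFun.insert {f g : (ι → M) → ZFSet.{u}} [hf : DefFun M f] [hg : DefFun M g] :
    DefFun M fun v => Insert.insert (f v) (g v) := by
  have : DefFun M fun v => ({f v, f v} ∪ g v : ZFSet.{u}) := inferInstance
  simpa only [ZFSet.pair_eq_singleton, ← ZFSet.insert_eq] using this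

theorem prod_mem {x y : ZFSet.{u}} (hx : x ∈ M) (hy : y ∈ M) : ZFSet.prod x y ∈ M := by
  have h1 := Fact.mk hx
  have h2 := Fact.mk hy
  have := sep_mem (pow_mem (pow_mem (union_mem hx hy)))
    (fun p => ∃ a, a ∈ x ∧ ∃ b, b ∈ y ∧ p = ZFSet.pair a b)
  convert this using 1
  ext p
  simp only [ZFSet.mem_prod, ZFSet.mem_sep, mem_pow]
  refine ⟨fun h => ⟨?_, h⟩, fun h => h.2⟩
  obtain ⟨a, ha, b, hb, rfl⟩ := h
  have ha' := mem_of_mem hx ha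
  have hb' := mem_of_mem hy hb
  refine ⟨fun s hs => ?_, pair_mem ha' hb'⟩
  have : s = {a} ∨ s = {a, b} := by simpa [ZFSet.pair] using hs
  rcases this with rfl | rfl
  · exact mem_pow.2 ⟨fun t ht => by simp at ht; simp [ht, ha], singleton_mem ha'⟩
  · refine mem_pow.2 ⟨fun t ht => ?_, upair_mem ha' hb'⟩
    rcases ZFSet.mem_pair.1 ht with rfl | rfl <;> simp [*]

/-- The relation `{(x, y) ∈ A × B | P x y}` as a set of ordered pairs. -/
noncomputable def rel (A B : ZFSet.{u}) (P : ZFSet.{u} → ZFSet.{u} → Prop) : ZFSet.{u} :=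
  ZFSet.sep (fun p => ∃ a, a ∈ A ∧ ∃ b, b ∈ B ∧ p = ZFSet.pair a b ∧ P a b) (ZFSet.prod A B)

omit hM in
@[simp] theorem pair_mem_rel {A B : ZFSet.{u}} {P : ZFSet.{u} → ZFSet.{u} → Prop} {x y : ZFSet.{u}} :
    ZFSet.pair x y ∈ rel A B P ↔ x ∈ A ∧ y ∈ B ∧ P x y := by
  simp only [rel, ZFSet.mem_sep, ZFSet.pair_mem_prod]
  constructor
  · rintro ⟨-, a, ha, b, hb, h, hP⟩
    obtain ⟨rfl, rfl⟩ := ZFSet.pair_injective h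
    exact ⟨ha, hb, hP⟩
  · rintro ⟨ha, hb, hP⟩
    exact ⟨⟨ha, hb⟩, x, ha, y, hb, rfl, hP⟩

omit hM in
theorem rel_subset {A B : ZFSet.{u}} {P : ZFSet.{u} → ZFSet.{u} → Prop} :
    rel A B P ⊆ ZFSet.prod A B := ZFSet.sep_subset

theorem rel_mem {A B : ZFSet.{u}} (hA : A ∈ M) (hB : B ∈ M) (P : ZFSet.{u} → ZFSet.{u} → Prop)
    [h : DefPred M fun w : Fin 2 → M => P (w 0) (w 1)] : rel A B P ∈ M := by
  have h1 := Fact.mk hA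
  have h2 := Fact.mk hB
  have : DefPred M fun w : ((Fin 1 ⊕ Fin 1) ⊕ Fin 1) → M => P (w (.inl (.inr 0))) (w (.inr 0)) :=
    h.reindex (![.inl (.inr 0), .inr 0] : Fin 2 → (Fin 1 ⊕ Fin 1) ⊕ Fin 1)
  exact sep_mem (prod_mem hA hB) _

end Closure
/-! ### Functions as sets of ordered pairs -/

section Functions

variable {A B f x y y' : ZFSet.{u}}

theorem isFunc_dom (h : ZFSet.IsFunc A B f) (hx : ZFSet.pair x y ∈ f) : x ∈ A :=
  (ZFSet.pair_mem_prod.1 (h.1 hx)).1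

theorem isFunc_cod (h : ZFSet.IsFunc A B f) (hx : ZFSet.pair x y ∈ f) : y ∈ B :=
  (ZFSet.pair_mem_prod.1 (h.1 hx)).2

theorem isFunc_unique (h : ZFSet.IsFunc A B f) (hx : ZFSet.pair x y ∈ f)
    (hx' : ZFSet.pair x y' ∈ f) : y = y' :=
  (h.2 x (isFunc_dom h hx)).unique hx hx'

theorem isFunc_total (h : ZFSet.IsFunc A B f) (hx : x ∈ A) : ∃ y ∈ B, ZFSet.pair x y ∈ f := by
  obtain ⟨y, hy, -⟩ := h.2 x hx
  exact ⟨y, isFunc_cod h hy, hy⟩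

theorem isFunc_rel {P : ZFSet.{u} → ZFSet.{u} → Prop} (h : ∀ x ∈ A, ∃ y ∈ B, P x y)
    (h' : ∀ x ∈ A, ∀ y ∈ B, ∀ z ∈ B, P x y → P x z → y = z) : ZFSet.IsFunc A B (rel A B P) := by
  refine ⟨rel_subset, fun x hx => ?_⟩
  obtain ⟨y, hy, hP⟩ := h x hx
  refine ⟨y, pair_mem_rel.2 ⟨hx, hy, hP⟩, fun z hz => ?_⟩
  obtain ⟨-, hz, hPz⟩ := pair_mem_rel.1 hz
  exact h' x hx z hz y hy hPz hP

theorem pair_mem_restrict {f a x y : ZFSet.{u}} :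
    ZFSet.pair x y ∈ restrict f a ↔ ZFSet.pair x y ∈ f ∧ x ∈ a := by
  simp only [restrict, ZFSet.mem_sep]
  refine and_congr_right fun _ => ⟨?_, fun h => ⟨x, h, y, rfl⟩⟩
  rintro ⟨ξ, hξ, z, h⟩
  rwa [(ZFSet.pair_injective h).1]

end Functions

/-! ### Regular cardinals of a model -/

section Regular

variable {M N : Set ZFSet.{u}} {δ α : ZFSet.{u}}

theorem IsRegularIn.mono (h : IsRegularIn N δ) (hMN : M ⊆ N) (hδ : δ ∈ M) : IsRegularIn M δ :=
  ⟨hδ, h.2.1, h.2.2.1, fun α hα f hf => h.2.2.2 α hα f (hMN hf)⟩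

variable [hM : TransModel M]

/-- If every `ξ < α` has a bound `γ < δ` for an upward closed property, then, `δ` being regular,
some bound works for all `ξ < α`: otherwise the least bounds would be cofinal in `δ`. -/
theorem IsRegularIn.exists_bound (hδ : IsRegularIn M δ) (hα : α ∈ δ)
    (P : ZFSet.{u} → ZFSet.{u} → Prop) [hP : DefPred M fun w : Fin 2 → M => P (w 0) (w 1)]
    (h : ∀ ξ ∈ α, ∃ γ ∈ δ, P ξ γ)
    (hup : ∀ ξ ∈ α, ∀ γ ∈ δ, ∀ γ' ∈ δ, P ξ γ → γ ⊆ γ' → P ξ γ') :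
    ∃ β ∈ δ, ∀ ξ ∈ α, P ξ β := by
  have inst : ∀ {ι : Type} {f g : (ι → M) → ZFSet.{u}} [DefFun M f] [DefFun M g],
      DefPred M fun v => P (f v) (g v) := DefPred.subst₂ ‹_› ‹_› hP
  have hord := hδ.2.1
  let Q : ZFSet.{u} → ZFSet.{u} → Prop := fun ξ γ => P ξ γ ∧ ∀ γ', γ' ∈ γ → ¬ P ξ γ'
  have hQ : DefPred M fun w : Fin 2 → M => Q (w 0) (w 1) :=
    inferInstanceAs (DefPred M fun w : Fin 2 → M => P (w 0) (w 1) ∧ ∀ γ', γ' ∈ (w 1 : ZFSet.{u}) →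
      ¬ P (w 0) γ')
  have hf : ZFSet.IsFunc α δ (rel α δ Q) := by
    refine isFunc_rel (fun ξ hξ => ?_) fun ξ _ γ hγ γ' hγ' h1 h2 => ?_
    · obtain ⟨γ, ⟨hγ, hPγ⟩, hmin⟩ := ZFSet.mem_wf.has_min {γ | γ ∈ δ ∧ P ξ γ} (h ξ hξ)
      exact ⟨γ, hγ, hPγ, fun γ' hγ' hP' => hmin γ' ⟨hord.mem_trans hγ' hγ, hP'⟩ hγ'⟩
    · rcases (hord.mem hγ).mem_trichotomous (hord.mem hγ') with h | h | h
      · exact absurd h1.1 (h2.2 _ h)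
      · exact h
      · exact absurd h2.1 (h1.2 _ h)
  have := hδ.2.2.2 α hα _ (rel_mem (mem_of_mem hδ.1 hα) hδ.1 Q) hf
  push Not at this
  obtain ⟨β, hβ, hbd⟩ := this
  refine ⟨β, hβ, fun ξ hξ => ?_⟩
  obtain ⟨γ, hγ, hξγ⟩ := isFunc_total hf hξ
  have hsub := (hord.mem hβ).not_subset_iff_mem (hord.mem hγ) |>.1 (hbd ξ γ hξγ)
  exact hup ξ hξ γ hγ β hβ (pair_mem_rel.1 hξγ).2.2.1 ((hord.mem hβ).subset_of_mem hsub)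

omit hM in
theorem IsRegularIn.empty_mem (hδ : IsRegularIn M δ) : (∅ : ZFSet.{u}) ∈ δ :=
  hδ.2.2.1 ZFSet.omega_zero

omit hM in
theorem IsRegularIn.one_mem (hδ : IsRegularIn M δ) : ({∅} : ZFSet.{u}) ∈ δ :=
  hδ.2.2.1 (by simpa using ZFSet.omega_succ ZFSet.omega_zero)

theorem IsRegularIn.succ_mem (hδ : IsRegularIn M δ) (hα : α ∈ δ) : insert α α ∈ δ := by
  have hαM := Fact.mk (mem_of_mem hδ.1 hα)
  have hord := hδ.2.1
  by_contra hcon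
  -- Otherwise `δ = α + 1`, and the constant function `1 → δ` with value `α` is cofinal.
  refine hδ.2.2.2 {∅} hδ.one_mem _
    (rel_mem (mem_of_mem hδ.1 hδ.one_mem) hδ.1 fun _ γ => γ = α)
    (isFunc_rel (fun _ _ => ⟨α, hα, rfl⟩) fun _ _ _ _ _ _ h1 h2 => h1.trans h2.symm) ?_
  refine fun β hβ => ⟨∅, α, by simp [hα], ?_⟩
  have := ((ZFSet.isOrdinal_succ (hord.mem hα)).notMem_iff_subset hord).1 hcon hβ
  rcases ZFSet.mem_insert_iff.1 this with rfl | h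
  · exact fun _ h => h
  · exact (hord.mem hα).subset_of_mem h

end Regular

/-! ### Mostowski collapses inside a model -/

section Collapse

/-- The Mostowski collapse of a well-founded relation `E` on a set `D`, computed in the ambient
universe: `collapse D E d = {collapse D E c | c ∈ D, c E d}`. -/
noncomputable def collapse (D : ZFSet.{u}) {E : ZFSet.{u} → ZFSet.{u} → Prop}
    (hE : WellFounded E) : ZFSet.{u} → ZFSet.{u} :=
  hE.fix fun d ih => ZFSet.range fun c : ↥(ZFSet.sep (fun c => E c d) D) =>
    ih c.1 (ZFSet.mem_sep.1 c.2).2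

theorem mem_collapse {D : ZFSet.{u}} {E : ZFSet.{u} → ZFSet.{u} → Prop} {hE : WellFounded E}
    {d y : ZFSet.{u}} : y ∈ collapse D hE d ↔ ∃ c ∈ D, E c d ∧ collapse D hE c = y := by
  rw [collapse, hE.fix_eq, ZFSet.mem_range]
  constructor
  · rintro ⟨⟨c, hc⟩, rfl⟩
    exact ⟨c, (ZFSet.mem_sep.1 hc).1, (ZFSet.mem_sep.1 hc).2, rfl⟩
  · rintro ⟨c, hc, hcd, rfl⟩
    exact ⟨⟨c, ZFSet.mem_sep.2 ⟨hc, hcd⟩⟩, rfl⟩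

variable {M : Set ZFSet.{u}} [hM : TransModel M]

/-- The Mostowski collapse `F` of a definable well-founded relation on a set `D` belongs to the
model as soon as its values are bounded by a set `U` of the model: replacement is not needed, since
`F` is the union of its partial approximations, all of which are subsets of `D × U`. -/
theorem exists_collapse_mem {D U : ZFSet.{u}} (hD : D ∈ M) (hU : U ∈ M)
    {E : ZFSet.{u} → ZFSet.{u} → Prop} (hwf : WellFounded E)
    [hE : DefPred M fun w : Fin 2 → M => E (w 0) (w 1)] {F : ZFSet.{u} → ZFSet.{u}}
    (hF : ∀ d ∈ D, ∀ y, y ∈ F d ↔ ∃ c ∈ D, E c d ∧ F c = y)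
    (hFU : ∀ d ∈ D, F d ∈ M → F d ∈ U) :
    ∃ Φ ∈ M, Φ ⊆ ZFSet.prod D U ∧ ∀ d y, ZFSet.pair d y ∈ Φ ↔ d ∈ D ∧ y = F d := by
  have inst : ∀ {ι : Type} {f g : (ι → M) → ZFSet.{u}} [DefFun M f] [DefFun M g],
      DefPred M fun v => E (f v) (g v) := DefPred.subst₂ ‹_› ‹_› hE
  have hD' := Fact.mk hD
  have hU' := Fact.mk hU
  have hDU := Fact.mk (prod_mem hD hU)
  -- `Att f`: `f` is a partial approximation to `F`, with domain closed under `E`-predecessors.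
  let Att : ZFSet.{u} → Prop := fun f => f ⊆ ZFSet.prod D U ∧ ∀ c, c ∈ D → ∀ t, t ∈ U →
    ZFSet.pair c t ∈ f → (∀ d, d ∈ D → E d c → ∃ s, s ∈ t ∧ ZFSet.pair d s ∈ f) ∧
      (∀ s, s ∈ t → ∃ d, d ∈ D ∧ (E d c ∧ ZFSet.pair d s ∈ f))
  have huniq : ∀ f, Att f → ∀ c ∈ D, ∀ t, ZFSet.pair c t ∈ f → t = F c := by
    intro f hf c
    induction c using hwf.induction with
    | _ c ih =>
      intro hc t hct
      obtain ⟨h1, h2⟩ := hf.2 c hc t (ZFSet.pair_mem_prod.1 (hf.1 hct)).2 hct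
      ext s
      rw [hF c hc]
      constructor
      · intro hs
        obtain ⟨d, hd, hdc, hds⟩ := h2 s hs
        exact ⟨d, hd, hdc, (ih d hdc hd s hds).symm⟩
      · rintro ⟨d, hd, hdc, rfl⟩
        obtain ⟨s, hs, hds⟩ := h1 d hd hdc
        rwa [← ih d hdc hd s hds]
  let Φ := rel D U fun c t => ∃ f, f ∈ M ∧ (Att f ∧ ZFSet.pair c t ∈ f)
  have hΦ : Φ ∈ M := by
    refine rel_mem hD hU _ (h := ?_)
    dsimp only [Att]
    infer_instance
  have hΦatt : Att Φ := by
    refine ⟨rel_subset, fun c hc t ht hct => ?_⟩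
    obtain ⟨-, -, f, hfM, hf, hctf⟩ := pair_mem_rel.1 hct
    obtain ⟨h1, h2⟩ := hf.2 c hc t ht hctf
    have sub : ∀ {d s}, ZFSet.pair d s ∈ f → ZFSet.pair d s ∈ Φ := fun {d s} h => by
      have := ZFSet.pair_mem_prod.1 (hf.1 h)
      exact pair_mem_rel.2 ⟨this.1, this.2, f, hfM, hf, h⟩
    refine ⟨fun d hd hdc => ?_, fun s hs => ?_⟩
    · obtain ⟨s, hs, hds⟩ := h1 d hd hdc
      exact ⟨s, hs, sub hds⟩
    · obtain ⟨d, hd, hdc, hds⟩ := h2 s hs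
      exact ⟨d, hd, hdc, sub hds⟩
  -- `Φ`, the union of all approximations, is total: `Φ ∪ {(b, F b)}` is again an approximation.
  have hex : ∀ d ∈ D, ZFSet.pair d (F d) ∈ Φ := by
    intro b
    induction b using hwf.induction with
    | _ b ih =>
      intro hb
      have hΦ' := Fact.mk hΦ
      have hb' := Fact.mk (mem_of_mem hD hb)
      have hFb : F b = ZFSet.sep (fun s => ∃ c, c ∈ D ∧ (E c b ∧ ZFSet.pair c s ∈ Φ)) U := by
        ext y
        rw [hF b hb, ZFSet.mem_sep]
        constructor
        · rintro ⟨c, hc, hcb, rfl⟩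
          have := ih c hcb hc
          exact ⟨(ZFSet.pair_mem_prod.1 (hΦatt.1 this)).2, c, hc, hcb, this⟩
        · rintro ⟨-, c, hc, hcb, h⟩
          exact ⟨c, hc, hcb, (huniq Φ hΦatt c hc y h).symm⟩
      have hFbM : F b ∈ M := by
        rw [hFb]
        exact sep_mem hU _
      have hFbU := hFU b hb hFbM
      refine pair_mem_rel.2 ⟨hb, hFbU, insert (ZFSet.pair b (F b)) Φ,
        insert_mem (pair_mem (mem_of_mem hD hb) hFbM) hΦ, ⟨?_, ?_⟩, ZFSet.mem_insert _ _⟩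
      · intro p hp
        rcases ZFSet.mem_insert_iff.1 hp with rfl | hp
        · exact ZFSet.pair_mem_prod.2 ⟨hb, hFbU⟩
        · exact hΦatt.1 hp
      · intro c hc t ht hct
        rcases ZFSet.mem_insert_iff.1 hct with h | h
        · obtain ⟨rfl, rfl⟩ := ZFSet.pair_injective h
          refine ⟨fun d hd hdc => ⟨F d, (hF c hc _).2 ⟨d, hd, hdc, rfl⟩,
            ZFSet.mem_insert_of_mem _ (ih d hdc hd)⟩, fun s hs => ?_⟩
          obtain ⟨d, hd, hdc, rfl⟩ := (hF c hc _).1 hs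
          exact ⟨d, hd, hdc, ZFSet.mem_insert_of_mem _ (ih d hdc hd)⟩
        · obtain ⟨h1, h2⟩ := hΦatt.2 c hc t ht h
          refine ⟨fun d hd hdc => ?_, fun s hs => ?_⟩
          · obtain ⟨s, hs, hds⟩ := h1 d hd hdc
            exact ⟨s, hs, ZFSet.mem_insert_of_mem _ hds⟩
          · obtain ⟨d, hd, hdc, hds⟩ := h2 s hs
            exact ⟨d, hd, hdc, ZFSet.mem_insert_of_mem _ hds⟩
  refine ⟨Φ, hΦ, hΦatt.1, fun d y => ⟨fun h => ?_, ?_⟩⟩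
  · have := ZFSet.pair_mem_prod.1 (hΦatt.1 h)
    exact ⟨this.1, huniq Φ hΦatt d this.1 y h⟩
  · rintro ⟨hd, rfl⟩
    exact hex d hd

end Collapse
/-! ### Gödel pairing -/

section Pairing

variable {δ : ZFSet.{u}}

/-- Gödel's well-order of `δ × δ`: pairs `(a, b)` are compared by the maximum `a ∪ b`, then by `a`,
then by `b`. -/
def GodelLT (δ p q : ZFSet.{u}) : Prop :=
  ∃ a, a ∈ δ ∧ ∃ b, b ∈ δ ∧ ∃ c, c ∈ δ ∧ ∃ d, d ∈ δ ∧ (p = ZFSet.pair a b ∧ q = ZFSet.pair c d ∧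
    (a ∪ b ∈ c ∪ d ∨ (a ∪ b = c ∪ d ∧ (a ∈ c ∨ (a = c ∧ b ∈ d)))))

theorem godelLT_pair {a b c d : ZFSet.{u}} :
    GodelLT δ (ZFSet.pair a b) (ZFSet.pair c d) ↔ a ∈ δ ∧ b ∈ δ ∧ c ∈ δ ∧ d ∈ δ ∧
      (a ∪ b ∈ c ∪ d ∨ (a ∪ b = c ∪ d ∧ (a ∈ c ∨ (a = c ∧ b ∈ d)))) := by
  constructor
  · rintro ⟨a', ha, b', hb, c', hc, d', hd, h1, h2, h⟩
    obtain ⟨rfl, rfl⟩ := ZFSet.pair_injective h1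
    obtain ⟨rfl, rfl⟩ := ZFSet.pair_injective h2
    exact ⟨ha, hb, hc, hd, h⟩
  · rintro ⟨ha, hb, hc, hd, h⟩
    exact ⟨a, ha, b, hb, c, hc, d, hd, rfl, rfl, h⟩

theorem godelLT_wf (δ : ZFSet.{u}) : WellFounded (GodelLT δ) := by
  classical
  let k : ZFSet.{u} → ZFSet.{u} × ZFSet.{u} × ZFSet.{u} := fun p =>
    if h : ∃ q : ZFSet.{u} × ZFSet.{u}, p = ZFSet.pair q.1 q.2 then
      (h.choose.1 ∪ h.choose.2, h.choose.1, h.choose.2) else (∅, ∅, ∅)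
  have hk : ∀ a b, k (ZFSet.pair a b) = (a ∪ b, a, b) := fun a b => by
    have h : ∃ q : ZFSet.{u} × ZFSet.{u}, ZFSet.pair a b = ZFSet.pair q.1 q.2 := ⟨(a, b), rfl⟩
    obtain ⟨h1, h2⟩ := ZFSet.pair_injective h.choose_spec
    simp only [k, dif_pos h, ← h1, ← h2]
  have wf := (ZFSet.mem_wf.{u}.prod_lex (ZFSet.mem_wf.{u}.prod_lex ZFSet.mem_wf.{u}))
  refine Subrelation.wf (fun {p q} h => ?_) (InvImage.wf k wf)
  obtain ⟨a, -, b, -, c, -, d, -, rfl, rfl, h⟩ := h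
  simp only [InvImage, hk, Prod.lex_def]
  exact h

/-- Gödel's pairing function, as a relation: the collapse of `GodelLT δ`, cut down to values in
`δ`. -/
noncomputable def godelPairing (δ : ZFSet.{u}) : ZFSet.{u} :=
  rel (ZFSet.prod δ δ) δ fun p t => t = collapse (ZFSet.prod δ δ) (godelLT_wf δ) p

theorem union_eq_or {a b : ZFSet.{u}} (ha : a.IsOrdinal) (hb : b.IsOrdinal) :
    a ∪ b = a ∨ a ∪ b = b := by
  rcases ha.subset_total hb with h | h
  · exact .inr (by ext z; simpa using fun hz => h hz)
  · exact .inl (by ext z; simpa using fun hz => h hz)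

theorem godelLT_trans (hδ : δ.IsOrdinal) {p q r : ZFSet.{u}} (h1 : GodelLT δ p q)
    (h2 : GodelLT δ q r) : GodelLT δ p r := by
  obtain ⟨a, ha, b, hb, c, hc, d, hd, rfl, rfl, h⟩ := h1
  obtain ⟨c', -, d', -, e, he, f, hf, hq, rfl, h'⟩ := h2
  obtain ⟨rfl, rfl⟩ := ZFSet.pair_injective hq
  refine godelLT_pair.2 ⟨ha, hb, he, hf, ?_⟩
  have oe : (e ∪ f).IsOrdinal := by
    rcases union_eq_or (hδ.mem he) (hδ.mem hf) with h | h <;> rw [h]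
    exacts [hδ.mem he, hδ.mem hf]
  rcases h with h | ⟨h, h0⟩
  · rcases h' with h' | ⟨h', -⟩
    · exact .inl (oe.mem_trans h h')
    · exact .inl (h' ▸ h)
  · rcases h' with h' | ⟨h', h0'⟩
    · exact .inl (h ▸ h')
    · refine .inr ⟨h.trans h', ?_⟩
      rcases h0 with h0 | ⟨rfl, h0⟩
      · rcases h0' with h0' | ⟨rfl, -⟩
        · exact .inl ((hδ.mem he).mem_trans h0 h0')
        · exact .inl h0
      · rcases h0' with h0' | ⟨rfl, h0'⟩
        · exact .inl h0'
        · exact .inr ⟨rfl, (hδ.mem hf).mem_trans h0 h0'⟩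

theorem godelLT_total (hδ : δ.IsOrdinal) {a b c d : ZFSet.{u}} (ha : a ∈ δ) (hb : b ∈ δ)
    (hc : c ∈ δ) (hd : d ∈ δ) : GodelLT δ (ZFSet.pair a b) (ZFSet.pair c d) ∨
      (a = c ∧ b = d) ∨ GodelLT δ (ZFSet.pair c d) (ZFSet.pair a b) := by
  simp only [godelLT_pair, ha, hb, hc, hd, true_and]
  have o1 : (a ∪ b).IsOrdinal := by
    rcases union_eq_or (hδ.mem ha) (hδ.mem hb) with h | h <;> rw [h]
    exacts [hδ.mem ha, hδ.mem hb]
  have o2 : (c ∪ d).IsOrdinal := by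
    rcases union_eq_or (hδ.mem hc) (hδ.mem hd) with h | h <;> rw [h]
    exacts [hδ.mem hc, hδ.mem hd]
  have h1 := o1.mem_trichotomous o2
  have h2 := (hδ.mem ha).mem_trichotomous (hδ.mem hc)
  have h3 := (hδ.mem hb).mem_trichotomous (hδ.mem hd)
  have e1 : a ∪ b = c ∪ d ↔ c ∪ d = a ∪ b := eq_comm
  have e2 : a = c ↔ c = a := eq_comm
  tauto

/-- The properties of Gödel's pairing function used below, for a relation `G ⊆ (δ × δ) × δ`. -/
structure IsPairing (G δ : ZFSet.{u}) : Prop where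
  total : ∀ ξ ∈ δ, ∀ η ∈ δ, ∃ t ∈ δ, ZFSet.pair (ZFSet.pair ξ η) t ∈ G
  inj : ∀ {ξ η ξ' η' t}, ZFSet.pair (ZFSet.pair ξ η) t ∈ G → ZFSet.pair (ZFSet.pair ξ' η') t ∈ G →
    ξ = ξ' ∧ η = η'
  dom : ∀ {ξ η t}, ZFSet.pair (ZFSet.pair ξ η) t ∈ G → ξ ∈ δ ∧ η ∈ δ ∧ t ∈ δ
  le : ∀ {ξ η t}, ZFSet.pair (ZFSet.pair ξ η) t ∈ G → ξ ⊆ t ∧ η ⊆ t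
  bounded : ∀ m ∈ δ, ∃ b ∈ δ, ∀ ξ ∈ m, ∀ η ∈ m, ∀ t, ZFSet.pair (ZFSet.pair ξ η) t ∈ G → t ∈ b

variable {M : Set ZFSet.{u}} [hM : TransModel M]

/-- The Gödel well-order of `δ × δ` has order type at most `δ`: a proper initial segment is
contained in `m × m` for some `m < δ`, so by regularity, applied once in each coordinate, the
values of the collapse on it are bounded below `δ`. -/
theorem collapse_godelLT_mem (hδ : IsRegularIn M δ) {p : ZFSet.{u}} (hp : p ∈ ZFSet.prod δ δ) :
    collapse (ZFSet.prod δ δ) (godelLT_wf δ) p ∈ δ := by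
  have hord := hδ.2.1
  have hδM := Fact.mk hδ.1
  set F := collapse (ZFSet.prod δ δ) (godelLT_wf δ) with hF
  induction p using (godelLT_wf δ).induction with
  | _ p ih =>
  have hE : DefPred M fun w : Fin 2 → M => GodelLT δ (w 0) (w 1) := by
    unfold GodelLT
    infer_instance
  have inst : ∀ {ι : Type} {f g : (ι → M) → ZFSet.{u}} [DefFun M f] [DefFun M g],
      DefPred M fun v => GodelLT δ (f v) (g v) := DefPred.subst₂ ‹_› ‹_› hE
  have hDM := prod_mem hδ.1 hδ.1
  have hpM := Fact.mk (mem_of_mem hDM hp)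
  let D := ZFSet.sep (fun c => GodelLT δ c p) (ZFSet.prod δ δ)
  have hD : D ∈ M := sep_mem hDM _
  obtain ⟨Φ, hΦ, -, hΦF⟩ := exists_collapse_mem (F := F) hD hδ.1 (godelLT_wf δ) (fun d hd y => by
      rw [hF, mem_collapse]
      obtain ⟨-, hdp⟩ := ZFSet.mem_sep.1 hd
      refine exists_congr fun c => ⟨?_, ?_⟩
      · rintro ⟨hc, hcd, rfl⟩
        exact ⟨ZFSet.mem_sep.2 ⟨hc, godelLT_trans hord hcd hdp⟩, hcd, rfl⟩
      · rintro ⟨hc, hcd, rfl⟩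
        exact ⟨(ZFSet.mem_sep.1 hc).1, hcd, rfl⟩)
    (fun d hd _ => ih d (ZFSet.mem_sep.1 hd).2 (ZFSet.mem_sep.1 hd).1)
  have hΦ' := Fact.mk hΦ
  obtain ⟨a, ha, b, hb, rfl⟩ := ZFSet.mem_prod.1 hp
  have hab : a ∪ b ∈ δ := by
    rcases union_eq_or (hord.mem ha) (hord.mem hb) with h | h <;> rw [h] <;> assumption
  have hm := hδ.succ_mem hab
  set m := insert (a ∪ b) (a ∪ b) with hm_def
  have hmM := Fact.mk (mem_of_mem hδ.1 hm)
  -- The initial segment `D` below `(a, b)` is contained in `m × m`, for `m = max(a, b) + 1`.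
  have hseg : ∀ c ∈ D, ∃ x ∈ m, ∃ y ∈ m, c = ZFSet.pair x y := by
    intro c hc
    obtain ⟨x, hx, y, hy, a', ha', b', hb', rfl, hq, h⟩ := (ZFSet.mem_sep.1 hc).2
    obtain ⟨rfl, rfl⟩ := ZFSet.pair_injective hq
    have hsub : x ∪ y ⊆ a ∪ b := by
      rcases h with h | ⟨h, -⟩
      · exact (hord.mem hab).subset_of_mem h
      · rw [h]
    have key : ∀ z ∈ δ, z ⊆ a ∪ b → z ∈ m := fun z hz hzs => by
      rcases ((hord.mem hz).subset_iff_eq_or_mem (hord.mem hab)).1 hzs with h | h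
      · exact ZFSet.mem_insert_iff.2 (.inl h)
      · exact ZFSet.mem_insert_of_mem _ h
    exact ⟨x, key x hx fun z hz => hsub (ZFSet.mem_union.2 (.inl hz)),
      y, key y hy fun z hz => hsub (ZFSet.mem_union.2 (.inr hz)), rfl⟩
  obtain ⟨β, hβ, hbd⟩ := hδ.exists_bound hm
    (fun x γ => ∀ y, y ∈ m → ∀ t, t ∈ δ → ZFSet.pair (ZFSet.pair x y) t ∈ Φ → t ∈ γ)
    (fun x hx => by
      have hxM := Fact.mk (mem_of_mem hmM.out hx)
      refine hδ.exists_bound hm (fun y γ => ∀ t, t ∈ δ → ZFSet.pair (ZFSet.pair x y) t ∈ Φ → t ∈ γ)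
        (fun y hy => ?_) fun y _ γ _ γ' _ h hs t ht htΦ => hs (h t ht htΦ)
      by_cases h : ZFSet.pair x y ∈ D
      · refine ⟨_, hδ.succ_mem (ih _ (ZFSet.mem_sep.1 h).2 (ZFSet.mem_sep.1 h).1),
          fun t ht htΦ => ?_⟩
        rw [((hΦF _ _).1 htΦ).2]
        exact ZFSet.mem_insert _ _
      · exact ⟨∅, hδ.empty_mem, fun t ht htΦ => absurd ((hΦF _ _).1 htΦ).1 h⟩)
    (fun x _ γ _ γ' _ h hs y hy t ht htΦ => hs (h y hy t ht htΦ))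
  have hsub : F (ZFSet.pair a b) ⊆ β := by
    intro z hz
    obtain ⟨c, hc, hcp, rfl⟩ := mem_collapse.1 hz
    have hcD : c ∈ D := ZFSet.mem_sep.2 ⟨hc, hcp⟩
    obtain ⟨x, hx, y, hy, rfl⟩ := hseg c hcD
    exact hbd x hx y hy _ (ih _ hcp hc) ((hΦF _ _).2 ⟨hcD, rfl⟩)
  refine ZFSet.IsOrdinal.mem_of_subset_of_mem ?_ hord hsub hβ
  refine ZFSet.isOrdinal_iff_forall_mem_isOrdinal.2 ⟨fun z hz y hy => ?_, fun z hz => ?_⟩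
  · obtain ⟨c, hc, hcp, rfl⟩ := mem_collapse.1 hz
    obtain ⟨d, hd, hdc, rfl⟩ := mem_collapse.1 hy
    exact mem_collapse.2 ⟨d, hd, godelLT_trans hord hdc hcp, rfl⟩
  · obtain ⟨c, hc, hcp, rfl⟩ := mem_collapse.1 hz
    exact hord.mem (ih c hcp hc)

theorem pair_mem_godelPairing (hδ : IsRegularIn M δ) {p t : ZFSet.{u}} :
    ZFSet.pair p t ∈ godelPairing δ ↔
      p ∈ ZFSet.prod δ δ ∧ t = collapse (ZFSet.prod δ δ) (godelLT_wf δ) p := by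
  rw [godelPairing, pair_mem_rel]
  exact ⟨fun h => ⟨h.1, h.2.2⟩, fun h => ⟨h.1, h.2 ▸ collapse_godelLT_mem hδ h.1, h.2⟩⟩

theorem godelPairing_mem (hδ : IsRegularIn M δ) : godelPairing δ ∈ M := by
  have hδM := Fact.mk hδ.1
  have hE : DefPred M fun w : Fin 2 → M => GodelLT δ (w 0) (w 1) := by
    unfold GodelLT
    infer_instance
  obtain ⟨Φ, hΦ, -, hΦF⟩ := exists_collapse_mem (prod_mem hδ.1 hδ.1) hδ.1 (godelLT_wf δ)
    (fun _ _ _ => mem_collapse) (fun d hd _ => collapse_godelLT_mem hδ hd)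
  have hΦ' := Fact.mk hΦ
  have : godelPairing δ = rel (ZFSet.prod δ δ) δ fun p t => ZFSet.pair p t ∈ Φ := by
    unfold godelPairing rel
    congr 1
    ext p
    simp only [hΦF]
    grind
  rw [this]
  exact rel_mem (prod_mem hδ.1 hδ.1) hδ.1 _

theorem isPairing_godelPairing (hδ : IsRegularIn M δ) : IsPairing (godelPairing δ) δ := by
  have hord := hδ.2.1
  set F := collapse (ZFSet.prod δ δ) (godelLT_wf δ) with hF
  have hG : ∀ {p t}, ZFSet.pair p t ∈ godelPairing δ ↔ p ∈ ZFSet.prod δ δ ∧ t = F p :=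
    pair_mem_godelPairing hδ
  have hFδ : ∀ {p}, p ∈ ZFSet.prod δ δ → F p ∈ δ := fun h => collapse_godelLT_mem hδ h
  have hlt : ∀ {p q}, p ∈ ZFSet.prod δ δ → GodelLT δ p q → F p ∈ F q :=
    fun hp h => mem_collapse.2 ⟨_, hp, h, rfl⟩
  have hdiag : ∀ {m a b}, m ∈ δ → a ∈ δ → b ∈ δ → m ∈ a ∪ b →
      GodelLT δ (ZFSet.pair m m) (ZFSet.pair a b) := fun {m a b} hm ha hb h => by
    refine godelLT_pair.2 ⟨hm, hm, ha, hb, .inl ?_⟩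
    rcases union_eq_or (hord.mem hm) (hord.mem hm) with h' | h' <;> rwa [h']
  -- The diagonal values increase strictly, hence `m ≤ F (m, m)`.
  have hle : ∀ m ∈ δ, m ⊆ F (ZFSet.pair m m) := by
    intro m
    induction m using ZFSet.inductionOn with
    | _ m ih =>
    intro hm z hz
    have hzδ := hord.mem_trans hz hm
    have hzD := ZFSet.pair_mem_prod.2 ⟨hzδ, hzδ⟩
    have hmD := ZFSet.pair_mem_prod.2 ⟨hm, hm⟩
    exact (hord.mem hzδ).mem_of_subset_of_mem (hord.mem (hFδ hmD)) (ih z hz hzδ)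
      (hlt hzD (hdiag hzδ hm hm (ZFSet.mem_union.2 (.inl hz))))
  have hle' : ∀ a ∈ δ, ∀ b ∈ δ, a ∪ b ⊆ F (ZFSet.pair a b) := by
    intro a ha b hb z hz
    have hzδ : z ∈ δ := (ZFSet.mem_union.1 hz).elim (fun h => hord.mem_trans h ha)
      fun h => hord.mem_trans h hb
    exact (hord.mem hzδ).mem_of_subset_of_mem (hord.mem (hFδ (ZFSet.pair_mem_prod.2 ⟨ha, hb⟩)))
      (hle z hzδ) (hlt (ZFSet.pair_mem_prod.2 ⟨hzδ, hzδ⟩) (hdiag hzδ ha hb hz))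
  refine ⟨fun ξ hξ η hη => ?_, fun {ξ η ξ' η' t} h h' => ?_, fun {ξ η t} h => ?_,
    fun {ξ η t} h => ?_, fun m hm => ?_⟩
  · have := ZFSet.pair_mem_prod.2 ⟨hξ, hη⟩
    exact ⟨_, hFδ this, hG.2 ⟨this, rfl⟩⟩
  · obtain ⟨h1, rfl⟩ := hG.1 h
    obtain ⟨h2, h3⟩ := hG.1 h'
    obtain ⟨hξ, hη⟩ := ZFSet.pair_mem_prod.1 h1
    obtain ⟨hξ', hη'⟩ := ZFSet.pair_mem_prod.1 h2
    rcases godelLT_total hord hξ hη hξ' hη' with h | h | h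
    · exact absurd (h3 ▸ hlt h1 h) (ZFSet.mem_irrefl _)
    · exact h
    · exact absurd (h3 ▸ hlt h2 h) (ZFSet.mem_irrefl _)
  · obtain ⟨h1, rfl⟩ := hG.1 h
    have := ZFSet.pair_mem_prod.1 h1
    exact ⟨this.1, this.2, hFδ h1⟩
  · obtain ⟨h1, rfl⟩ := hG.1 h
    have h2 := ZFSet.pair_mem_prod.1 h1
    have h3 := hle' _ h2.1 _ h2.2
    exact ⟨fun z hz => h3 (ZFSet.mem_union.2 (.inl hz)), fun z hz => h3 (ZFSet.mem_union.2 (.inr hz))⟩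
  · have hmD := ZFSet.pair_mem_prod.2 ⟨hm, hm⟩
    refine ⟨_, hFδ hmD, fun ξ hξ η hη t ht => ?_⟩
    obtain ⟨h1, rfl⟩ := hG.1 ht
    refine hlt h1 (godelLT_pair.2 ⟨hord.mem_trans hξ hm, hord.mem_trans hη hm, hm, hm, .inl ?_⟩)
    rcases union_eq_or (hord.mem (hord.mem_trans hξ hm)) (hord.mem (hord.mem_trans hη hm)) with
      h | h <;> rw [h] <;> simp [hξ, hη]

end Pairing
/-! ### Sets of size less than a regular cardinal -/

section Small

variable {M : Set ZFSet.{u}} {δ U G : ZFSet.{u}}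

variable (M) in
/-- The set of all partial enumerations of subsets of `U` in `M` whose index set is bounded
in `δ`. -/
noncomputable def enums (δ U : ZFSet.{u}) : ZFSet.{u} :=
  ZFSet.sep (fun e => (∀ ξ, ξ ∈ δ → ∀ x, x ∈ U → ∀ y, y ∈ U → ZFSet.pair ξ x ∈ e →
    ZFSet.pair ξ y ∈ e → x = y) ∧ ∃ γ, γ ∈ δ ∧ ∀ ξ, ξ ∈ δ → ∀ x, x ∈ U → ZFSet.pair ξ x ∈ e → ξ ∈ γ)
    (pow M (ZFSet.prod δ U))

theorem mem_enums {e : ZFSet.{u}} : e ∈ enums M δ U ↔ e ⊆ ZFSet.prod δ U ∧ e ∈ M ∧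
    (∀ ξ x y, ZFSet.pair ξ x ∈ e → ZFSet.pair ξ y ∈ e → x = y) ∧
      ∃ γ ∈ δ, ∀ ξ x, ZFSet.pair ξ x ∈ e → ξ ∈ γ := by
  rw [enums, ZFSet.mem_sep, mem_pow, and_assoc]
  refine and_congr_right fun hsub => and_congr_right fun _ => ?_
  have h : ∀ {ξ x}, ZFSet.pair ξ x ∈ e → ξ ∈ δ ∧ x ∈ U := fun h => ZFSet.pair_mem_prod.1 (hsub h)
  refine and_congr ⟨fun H ξ x y hx hy => H ξ (h hx).1 x (h hx).2 y (h hy).2 hx hy,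
    fun H ξ _ x _ y _ hx hy => H ξ x y hx hy⟩ ?_
  refine exists_congr fun γ => and_congr_right fun _ => ⟨fun H ξ x hx => H ξ (h hx).1 x (h hx).2 hx,
    fun H ξ _ x _ hx => H ξ x hx⟩

variable [hM : TransModel M]

theorem enums_mem (hδ : δ ∈ M) (hU : U ∈ M) : enums M δ U ∈ M := by
  have h1 := Fact.mk hδ
  have h2 := Fact.mk hU
  exact sep_mem (pow_mem (prod_mem hδ hU)) _

theorem exists_enum {X : ZFSet.{u}} (hord : δ.IsOrdinal) (hδ : δ ∈ M) (hU : U ∈ M) (hXU : X ⊆ U)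
    (hX : SizeLT M X δ) : ∃ e ∈ enums M δ U, ∀ x, x ∈ X ↔ ∃ ξ, ZFSet.pair ξ x ∈ e := by
  obtain ⟨α, hα, f, hf, hfun, hinj⟩ := hX
  have h1 := Fact.mk hf
  refine ⟨rel δ U fun ξ x => ZFSet.pair x ξ ∈ f, mem_enums.2 ⟨rel_subset, rel_mem hδ hU _,
    fun ξ x y hx hy => ?_, α, hα, fun ξ x hx => isFunc_cod hfun (pair_mem_rel.1 hx).2.2⟩,
    fun x => ⟨fun hx => ?_, ?_⟩⟩
  · exact hinj x y ξ (pair_mem_rel.1 hx).2.2 (pair_mem_rel.1 hy).2.2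
  · obtain ⟨ξ, hξ, h⟩ := isFunc_total hfun hx
    exact ⟨ξ, pair_mem_rel.2 ⟨hord.mem_trans hξ hα, hXU hx, h⟩⟩
  · rintro ⟨ξ, h⟩
    exact isFunc_dom hfun (pair_mem_rel.1 h).2.2

/-- A set enumerated, possibly with repetitions, along an ordinal `γ` injects into `γ`: map each
element to its least index. -/
theorem sizeLE_of_enum {X γ e : ZFSet.{u}} (hX : X ∈ M) (hγ : γ ∈ M) (he : e ∈ M)
    (hord : γ.IsOrdinal) (hcov : ∀ x ∈ X, ∃ ξ ∈ γ, ZFSet.pair ξ x ∈ e)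
    (hfun : ∀ ξ x y, ZFSet.pair ξ x ∈ e → ZFSet.pair ξ y ∈ e → x = y) : SizeLE M X γ := by
  have h1 := Fact.mk he
  refine ⟨rel X γ fun x ξ => ZFSet.pair ξ x ∈ e ∧ ∀ η, η ∈ ξ → ZFSet.pair η x ∉ e,
    rel_mem hX hγ _ (h := by
      exact inferInstanceAs (DefPred M fun w : Fin 2 → M => ZFSet.pair (w 1) (w 0) ∈ e ∧
        ∀ η, η ∈ (w 1 : ZFSet.{u}) → ¬ ZFSet.pair η (w 0) ∈ e)),
    isFunc_rel (fun x hx => ?_) fun x _ ξ hξ η hη h h' => ?_, fun x y ξ hx hy => ?_⟩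
  · obtain ⟨ξ, ⟨hξ, hP⟩, hmin⟩ := ZFSet.mem_wf.has_min {ξ | ξ ∈ γ ∧ ZFSet.pair ξ x ∈ e} (hcov x hx)
    exact ⟨ξ, hξ, hP, fun η hη hP' => hmin η ⟨hord.mem_trans hη hξ, hP'⟩ hη⟩
  · rcases (hord.mem hξ).mem_trichotomous (hord.mem hη) with H | H | H
    · exact absurd h.1 (h'.2 _ H)
    · exact H
    · exact absurd h'.1 (h.2 _ H)
  · exact hfun ξ x y (pair_mem_rel.1 hx).2.2.1 (pair_mem_rel.1 hy).2.2.1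

/-- The union of a family of enumerations is enumerated along the pairing function. -/
theorem sizeLE_of_family {X A b s : ZFSet.{u}} (hG : IsPairing G δ) (hGM : G ∈ M) (hδ : δ ∈ M)
    (hU : U ∈ M) (hX : X ∈ M) (hXU : X ⊆ U) (hb : b ∈ M) (hord : b.IsOrdinal) (hA : A ⊆ δ)
    (hs : s ∈ M) (hfun : ZFSet.IsFunc A (enums M δ U) s)
    (hbd : ∀ ξ e η x t, ZFSet.pair ξ e ∈ s → ZFSet.pair η x ∈ e →
      ZFSet.pair (ZFSet.pair ξ η) t ∈ G → t ∈ b)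
    (hcov : ∀ x ∈ X, ∃ ξ e η, ZFSet.pair ξ e ∈ s ∧ ZFSet.pair η x ∈ e) : SizeLE M X b := by
  have h1 := Fact.mk hGM
  have h2 := Fact.mk hs
  have h3 := Fact.mk hδ
  have h4 := Fact.mk (enums_mem hδ hU)
  refine sizeLE_of_enum (e := rel δ U fun t x => ∃ ξ, ξ ∈ δ ∧ ∃ η, η ∈ δ ∧ ∃ e, e ∈ enums M δ U ∧
    (ZFSet.pair (ZFSet.pair ξ η) t ∈ G ∧ ZFSet.pair ξ e ∈ s ∧ ZFSet.pair η x ∈ e)) hX hb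
    (rel_mem hδ hU _) hord (fun x hx => ?_) fun t x y hx hy => ?_
  · obtain ⟨ξ, e, η, hξe, hηx⟩ := hcov x hx
    have hξ := hA (isFunc_dom hfun hξe)
    have he := isFunc_cod hfun hξe
    have hη := (ZFSet.pair_mem_prod.1 ((mem_enums.1 he).1 hηx)).1
    obtain ⟨t, ht, hGt⟩ := hG.total ξ hξ η hη
    exact ⟨t, hbd _ _ _ _ _ hξe hηx hGt,
      pair_mem_rel.2 ⟨ht, hXU hx, ξ, hξ, η, hη, e, he, hGt, hξe, hηx⟩⟩
  · obtain ⟨-, -, ξ, -, η, -, e, he, hGt, hξe, hηx⟩ := pair_mem_rel.1 hx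
    obtain ⟨-, -, ξ', -, η', -, e', -, hGt', hξe', hηx'⟩ := pair_mem_rel.1 hy
    obtain ⟨rfl, rfl⟩ := hG.inj hGt hGt'
    obtain rfl := isFunc_unique hfun hξe hξe'
    exact (mem_enums.1 he).2.2.1 _ _ _ hηx hηx'

/-- By regularity, the union of fewer than `δ` enumerated sets of size less than `δ` has size less
than `δ`. -/
theorem sizeLT_of_family {X A s : ZFSet.{u}} (hreg : IsRegularIn M δ)
    (hU : U ∈ M) (hX : X ∈ M) (hXU : X ⊆ U) (hA : A ∈ δ)
    (hs : s ∈ M) (hfun : ZFSet.IsFunc A (enums M δ U) s)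
    (hcov : ∀ x ∈ X, ∃ ξ e η, ZFSet.pair ξ e ∈ s ∧ ZFSet.pair η x ∈ e) : SizeLT M X δ := by
  have hord := hreg.2.1
  have hG := isPairing_godelPairing hreg
  have h2 := Fact.mk hs
  have h3 := Fact.mk hreg.1
  have h4 := Fact.mk (enums_mem hreg.1 hU)
  have h5 := Fact.mk hU
  obtain ⟨γ, hγ, hγb⟩ := hreg.exists_bound hA (fun ξ γ => ∀ e, e ∈ enums M δ U → ZFSet.pair ξ e ∈ s →
      ∀ η, η ∈ δ → ∀ x, x ∈ U → ZFSet.pair η x ∈ e → η ∈ γ)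
    (fun ξ hξ => by
      obtain ⟨e, he, hξe⟩ := isFunc_total hfun hξ
      obtain ⟨-, -, -, γ, hγ, hbd⟩ := mem_enums.1 he
      refine ⟨γ, hγ, fun e' _ hξe' η _ x _ hηx => ?_⟩
      obtain rfl := isFunc_unique hfun hξe hξe'
      exact hbd _ _ hηx)
    (fun ξ _ γ _ γ' _ h hs e he hξe η hη x hx hηx => hs (h e he hξe η hη x hx hηx))
  have hm : A ∪ γ ∈ δ := by
    rcases union_eq_or (hord.mem hA) (hord.mem hγ) with h | h <;> rw [h] <;> assumption
  obtain ⟨b, hb, hbd⟩ := hG.bounded _ hm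
  refine ⟨b, hb, sizeLE_of_family hG (godelPairing_mem hreg) hreg.1 hU hX hXU
    (mem_of_mem hreg.1 hb) (hord.mem hb) (hord.subset_of_mem hA) hs hfun ?_ hcov⟩
  intro ξ e η x t hξe hηx ht
  have he := isFunc_cod hfun hξe
  have hp := ZFSet.pair_mem_prod.1 ((mem_enums.1 he).1 hηx)
  have hη := hγb ξ (isFunc_dom hfun hξe) e he hξe η hp.1 x hp.2 hηx
  exact hbd ξ (ZFSet.mem_union.2 (.inl (isFunc_dom hfun hξe))) η
    (ZFSet.mem_union.2 (.inr hη)) t ht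

theorem sizeLT_union {X Y : ZFSet.{u}} (hreg : IsRegularIn M δ) (hU : U ∈ M) (hXM : X ∈ M)
    (hYM : Y ∈ M) (hXU : X ⊆ U) (hYU : Y ⊆ U) (hX : SizeLT M X δ) (hY : SizeLT M Y δ) :
    SizeLT M (X ∪ Y) δ := by
  obtain ⟨e, he, hXe⟩ := exists_enum hreg.2.1 hreg.1 hU hXU hX
  obtain ⟨e', he', hYe⟩ := exists_enum hreg.2.1 hreg.1 hU hYU hY
  have hS := enums_mem hreg.1 hU
  have h1 := Fact.mk (mem_of_mem hS he)
  have h2 := Fact.mk (mem_of_mem hS he')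
  have h3 : ({∅} : ZFSet.{u}) ≠ ∅ := fun h =>
    ZFSet.notMem_empty ∅ (ZFSet.ext_iff.1 h ∅ |>.1 (ZFSet.mem_singleton.2 rfl))
  -- The two enumerations, as a family indexed by `2 = {0, 1}`.
  let P : ZFSet.{u} → ZFSet.{u} → Prop := fun ξ y => (ξ = ∅ ∧ y = e) ∨ (ξ ≠ ∅ ∧ y = e')
  have hfun : ZFSet.IsFunc {{∅}, ∅} (enums M δ U) (rel {{∅}, ∅} (enums M δ U) P) := by
    refine isFunc_rel (fun ξ _ => ?_) fun ξ _ y _ z _ hy hz => ?_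
    · by_cases h : ξ = ∅
      · exact ⟨e, he, .inl ⟨h, rfl⟩⟩
      · exact ⟨e', he', .inr ⟨h, rfl⟩⟩
    · grind
  have h2δ : ({{∅}, ∅} : ZFSet.{u}) ∈ δ := hreg.succ_mem hreg.one_mem
  refine sizeLT_of_family hreg hU (union_mem hXM hYM) (fun z hz => ?_) h2δ
    (rel_mem (mem_of_mem hreg.1 h2δ) hS P) hfun fun x hx => ?_
  · exact (ZFSet.mem_union.1 hz).elim (fun h => hXU h) fun h => hYU h
  · rcases ZFSet.mem_union.1 hx with hx | hx
    · obtain ⟨η, hη⟩ := (hXe x).1 hx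
      exact ⟨∅, e, η, pair_mem_rel.2 ⟨by simp, he, .inl ⟨rfl, rfl⟩⟩, hη⟩
    · obtain ⟨η, hη⟩ := (hYe x).1 hx
      exact ⟨{∅}, e', η, pair_mem_rel.2 ⟨by simp, he', .inr ⟨h3, rfl⟩⟩, hη⟩

theorem sizeLT_singleton {w : ZFSet.{u}} (hreg : IsRegularIn M δ) (hw : w ∈ M) :
    SizeLT M {w} δ := by
  have h1 := Fact.mk hw
  refine ⟨{∅}, hreg.one_mem, rel {w} {∅} fun x _ => x = w,
    rel_mem (singleton_mem hw) (singleton_mem empty_mem) _, isFunc_rel ?_ ?_, ?_⟩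
  · exact fun x hx => ⟨∅, by simp, by simpa using hx⟩
  · intro x _ y hy z hz _ _
    simp only [ZFSet.mem_singleton] at hy hz
    rw [hy, hz]
  · intro x y z hx hy
    exact (pair_mem_rel.1 hx).2.2.trans (pair_mem_rel.1 hy).2.2.symm

end Small
/-! ### Extensional hulls -/

section Hull

/-- The bookkeeping device of the hull construction. For a sequence `s` of enumerations whose length
is `c + 1`, where `c` codes two pairs `(ξ, η)` and `(ξ', η')` of indices, `u = s(ξ)(η)` and
`v = s(ξ')(η')`. -/
def Requests (G δ S s u v : ZFSet.{u}) : Prop :=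
  ∃ ξ, ξ ∈ δ ∧ ∃ η, η ∈ δ ∧ ∃ ξ', ξ' ∈ δ ∧ ∃ η', η' ∈ δ ∧ ∃ a, a ∈ δ ∧ ∃ b, b ∈ δ ∧ ∃ c, c ∈ δ ∧
    (ZFSet.pair (ZFSet.pair ξ η) a ∈ G ∧ ZFSet.pair (ZFSet.pair ξ' η') b ∈ G ∧
      ZFSet.pair (ZFSet.pair a b) c ∈ G ∧
      (∃ e, e ∈ S ∧ (ZFSet.pair ξ e ∈ s ∧ ZFSet.pair η u ∈ e)) ∧
      (∃ e, e ∈ S ∧ (ZFSet.pair ξ' e ∈ s ∧ ZFSet.pair η' v ∈ e)) ∧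
      ∀ ζ, ζ ∈ δ → (ζ ∈ insert c c ↔ ∃ e, e ∈ S ∧ ZFSet.pair ζ e ∈ s))

/-- The relation to which `DC_δ` is applied: `y` enumerates a superset of some `C' ∈ 𝒞'`, which
contains some `C ∈ 𝒞`, which contains `A₀`, all sets enumerated along `s`, and an element on which
`u` and `v` differ if `s` requests one for `u` and `v`. -/
def HullStep (G δ U S A₀ 𝒞 𝒞' s y : ZFSet.{u}) : Prop :=
  ∃ C, C ∈ 𝒞 ∧ ∃ C', C' ∈ 𝒞' ∧ (A₀ ⊆ C ∧ C ⊆ C' ∧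
    (∀ ξ, ξ ∈ δ → ∀ e, e ∈ S → ZFSet.pair ξ e ∈ s →
      ∀ η, η ∈ δ → ∀ x, x ∈ U → ZFSet.pair η x ∈ e → x ∈ C) ∧
    (∀ x, x ∈ C' → ∃ η, η ∈ δ ∧ ZFSet.pair η x ∈ y) ∧
    ∀ u, u ∈ U → ∀ v, v ∈ U → Requests G δ S s u v → u ≠ v →
      ∃ w, w ∈ C ∧ ¬ (w ∈ u ↔ w ∈ v))

variable {W : Set ZFSet.{u}} {δ U : ZFSet.{u}}

theorem Requests.unique {G S s α u v u' v' : ZFSet.{u}} (hG : IsPairing G δ)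
    (hS : S = enums W δ U) (hs : ZFSet.IsFunc α S s) (h : Requests G δ S s u v)
    (h' : Requests G δ S s u' v') : u = u' ∧ v = v' := by
  subst hS
  obtain ⟨ξ₁, -, η₁, -, ξ₂, -, η₂, -, a, -, b, -, c, hc, ha, hb, hab, ⟨e₁, he₁, hs₁, hu⟩,
    ⟨e₂, he₂, hs₂, hv⟩, hdom⟩ := h
  obtain ⟨ξ₁', -, η₁', -, ξ₂', -, η₂', -, a', -, b', -, c', hc', ha', hb', hab', ⟨e₁', he₁', hs₁', hu'⟩,
    ⟨e₂', he₂', hs₂', hv'⟩, hdom'⟩ := h'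
  have hcc : c = c' := by
    have h1 := (hdom' c hc).2 ((hdom c hc).1 (ZFSet.mem_insert _ _))
    have h2 := (hdom c' hc').2 ((hdom' c' hc').1 (ZFSet.mem_insert _ _))
    rcases ZFSet.mem_insert_iff.1 h1 with h1 | h1
    · exact h1
    rcases ZFSet.mem_insert_iff.1 h2 with h2 | h2
    · exact h2.symm
    · exact absurd h2 (ZFSet.mem_asymm h1)
  subst hcc
  obtain ⟨rfl, rfl⟩ := hG.inj hab hab'
  obtain ⟨rfl, rfl⟩ := hG.inj ha ha'
  obtain ⟨rfl, rfl⟩ := hG.inj hb hb'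
  obtain rfl := isFunc_unique hs hs₁ hs₁'
  obtain rfl := isFunc_unique hs hs₂ hs₂'
  exact ⟨(mem_enums.1 he₁).2.2.1 _ _ _ hu hu', (mem_enums.1 he₂).2.2.1 _ _ _ hv hv'⟩

variable [hM : TransModel W]

theorem exists_hullStep (hreg : IsRegularIn W δ) (hU : U ∈ W) (hUtr : U.IsTransitive)
    {𝒞 𝒞' A₀ : ZFSet.{u}}
    (h𝒞U : ∀ C ∈ 𝒞, C ⊆ U ∧ C ∈ W) (h𝒞'U : ∀ C ∈ 𝒞', C ⊆ U ∧ C ∈ W)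
    (h𝒞 : ∀ X ∈ W, X ⊆ U → SizeLT W X δ → ∃ C ∈ 𝒞, X ⊆ C ∧ SizeLT W C δ)
    (h𝒞' : ∀ X ∈ W, X ⊆ U → SizeLT W X δ → ∃ C ∈ 𝒞', X ⊆ C ∧ SizeLT W C δ)
    (hA₀ : A₀ ∈ W) (hA₀U : A₀ ⊆ U) (hA₀δ : SizeLT W A₀ δ) {α s : ZFSet.{u}} (hα : α ∈ δ)
    (hs : s ∈ W) (hfun : ZFSet.IsFunc α (enums W δ U) s) :
    ∃ y ∈ enums W δ U, HullStep (godelPairing δ) δ U (enums W δ U) A₀ 𝒞 𝒞' s y := by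
  have hord := hreg.2.1
  have hG := isPairing_godelPairing hreg
  have hS := Fact.mk (enums_mem hreg.1 hU)
  have hδ := Fact.mk hreg.1
  have hsW := Fact.mk hs
  set S := enums W δ U with hSdef
  let X := ZFSet.sep (fun x => ∃ ξ, ξ ∈ δ ∧ ∃ e, e ∈ S ∧ ∃ η, η ∈ δ ∧
    (ZFSet.pair ξ e ∈ s ∧ ZFSet.pair η x ∈ e)) U
  have hXW : X ∈ W := sep_mem hU _
  have hXU : X ⊆ U := ZFSet.sep_subset
  have hXδ : SizeLT W X δ := by
    refine sizeLT_of_family hreg hU hXW hXU hα hs hfun fun x hx => ?_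
    obtain ⟨-, ξ, -, e, -, η, -, h1, h2⟩ := ZFSet.mem_sep.1 hx
    exact ⟨ξ, e, η, h1, h2⟩
  have hXA := sizeLT_union hreg hU hXW hA₀ hXU hA₀U hXδ hA₀δ
  have hXAU : X ∪ A₀ ⊆ U := fun z hz =>
    (ZFSet.mem_union.1 hz).elim (fun h => hXU h) fun h => hA₀U h
  have hXAW := union_mem hXW hA₀
  obtain ⟨D, hDW, hDU, hDδ, hXD, hDw⟩ : ∃ D ∈ W, D ⊆ U ∧ SizeLT W D δ ∧ X ∪ A₀ ⊆ D ∧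
      ∀ u, u ∈ U → ∀ v, v ∈ U → Requests (godelPairing δ) δ S s u v → u ≠ v →
        ∃ w, w ∈ D ∧ ¬ (w ∈ u ↔ w ∈ v) := by
    -- At most one pair `(u, v)` is requested, so no choice is needed to find the witness `w`.
    by_cases h : ∃ u ∈ U, ∃ v ∈ U, Requests (godelPairing δ) δ S s u v ∧ u ≠ v
    · obtain ⟨u, hu, v, hv, hr, huv⟩ := h
      obtain ⟨w, hw⟩ : ∃ w, ¬ (w ∈ u ↔ w ∈ v) := by
        by_contra hcon
        push Not at hcon
        exact huv (ZFSet.ext hcon)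
      have hwU : w ∈ U := by
        by_cases hwu : w ∈ u
        · exact hUtr.subset_of_mem hu hwu
        · exact hUtr.subset_of_mem hv (by tauto)
      have hwW := mem_of_mem hU hwU
      have hwU' : ({w} : ZFSet.{u}) ⊆ U := fun z hz => by rwa [ZFSet.mem_singleton.1 hz]
      refine ⟨(X ∪ A₀) ∪ {w}, union_mem hXAW (singleton_mem hwW), fun z hz => ?_,
        sizeLT_union hreg hU hXAW (singleton_mem hwW) hXAU hwU' hXA (sizeLT_singleton hreg hwW),
        fun z hz => ZFSet.mem_union.2 (.inl hz), fun u' _ v' _ hr' _ => ⟨w, by simp, ?_⟩⟩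
      · exact (ZFSet.mem_union.1 hz).elim (fun h => hXAU h) fun h => hwU' h
      · obtain ⟨rfl, rfl⟩ := hr.unique hG hSdef hfun hr'
        exact hw
    · push Not at h
      exact ⟨X ∪ A₀, hXAW, hXAU, hXA, fun _ h => h, fun u hu v hv hr huv =>
        absurd (h u hu v hv hr) huv⟩
  obtain ⟨C, hC, hDC, hCδ⟩ := h𝒞 D hDW hDU hDδ
  obtain ⟨C', hC', hCC', hCδ'⟩ := h𝒞' C (h𝒞U C hC).2 (h𝒞U C hC).1 hCδ
  obtain ⟨y, hy, hyC⟩ := exists_enum hord hreg.1 hU (h𝒞'U C' hC').1 hCδ'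
  refine ⟨y, hy, C, hC, C', hC', fun z hz => hDC (hXD (ZFSet.mem_union.2 (.inr hz))), hCC',
    fun ξ hξ e he hse η hη x hx hηx => hDC (hXD (ZFSet.mem_union.2 (.inl
      (ZFSet.mem_sep.2 ⟨hx, ξ, hξ, e, he, η, hη, hse, hηx⟩)))), fun x hx => ?_,
    fun u hu v hv hr huv => ?_⟩
  · obtain ⟨η, hη⟩ := (hyC x).1 hx
    exact ⟨η, (ZFSet.pair_mem_prod.1 ((mem_enums.1 hy).1 hη)).1, hη⟩
  · obtain ⟨w, hw, hwuv⟩ := hDw u hu v hv hr huv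
    exact ⟨w, hDC hw, hwuv⟩

/-- The hull construction. Let every small subset of `U` be covered by a small member of `𝒞`, and
likewise for `𝒞'`. Then every small `A₀ ⊆ U` is contained in an extensional `B ⊆ U` of size at most
`δ` which is, up to sets of size less than `δ`, a union of members of `𝒞`, and also of members of
`𝒞'`. -/
theorem exists_hull (hreg : IsRegularIn W δ) (hDC : ModelsDC W δ) (hU : U ∈ W)
    (hUtr : U.IsTransitive) {𝒞 𝒞' A₀ : ZFSet.{u}} (h𝒞W : 𝒞 ∈ W) (h𝒞'W : 𝒞' ∈ W)
    (h𝒞U : ∀ C ∈ 𝒞, C ⊆ U) (h𝒞'U : ∀ C ∈ 𝒞', C ⊆ U)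
    (h𝒞 : ∀ X ∈ W, X ⊆ U → SizeLT W X δ → ∃ C ∈ 𝒞, X ⊆ C ∧ SizeLT W C δ)
    (h𝒞' : ∀ X ∈ W, X ⊆ U → SizeLT W X δ → ∃ C ∈ 𝒞', X ⊆ C ∧ SizeLT W C δ)
    (hA₀ : A₀ ∈ W) (hA₀U : A₀ ⊆ U) (hA₀δ : SizeLT W A₀ δ) :
    ∃ B ∈ W, A₀ ⊆ B ∧ B ⊆ U ∧ SizeLE W B δ ∧
      (∀ u ∈ B, ∀ v ∈ B, u ≠ v → ∃ w ∈ B, ¬ (w ∈ u ↔ w ∈ v)) ∧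
      ∀ a ∈ W, SizeLT W a δ → (∃ C ∈ 𝒞, C ⊆ B ∧ B ∩ a ⊆ C) ∧ (∃ C ∈ 𝒞', C ⊆ B ∧ B ∩ a ⊆ C) := by
  have hord := hreg.2.1
  have hG := isPairing_godelPairing hreg
  have hSW := enums_mem hreg.1 hU
  have f1 := Fact.mk hSW
  have f2 := Fact.mk hreg.1
  have f3 := Fact.mk (godelPairing_mem hreg)
  have f4 := Fact.mk hA₀
  have f5 := Fact.mk h𝒞W
  have f6 := Fact.mk h𝒞'W
  have f7 := Fact.mk hU
  set S := enums W δ U with hSdef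
  set G := godelPairing δ with hGdef
  obtain ⟨y₀, hy₀, -⟩ := exists_enum hord hreg.1 hU hA₀U hA₀δ
  have hR : rel (pow W (ZFSet.prod δ S)) S (HullStep G δ U S A₀ 𝒞 𝒞') ∈ W := by
    refine rel_mem (pow_mem (prod_mem hreg.1 hSW)) hSW _ (h := ?_)
    unfold HullStep Requests
    set_option synthInstance.maxSize 2000 in
    set_option synthInstance.maxHeartbeats 400000 in
    infer_instance
  obtain ⟨f, hf, hfun, hstep⟩ := hDC.2 S hSW (ZFSet.nonempty_of_mem hy₀) _ hR (by
    rintro s hs ⟨α, hα, hsfun⟩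
    obtain ⟨y, hy, hstep⟩ := exists_hullStep hreg hU hUtr
      (fun C hC => ⟨h𝒞U C hC, mem_of_mem h𝒞W hC⟩) (fun C hC => ⟨h𝒞'U C hC, mem_of_mem h𝒞'W hC⟩)
      h𝒞 h𝒞' hA₀ hA₀U hA₀δ hα hs hsfun
    refine ⟨y, hy, pair_mem_rel.2 ⟨mem_pow.2 ⟨fun p hp => ?_, hs⟩, hy, hstep⟩⟩
    obtain ⟨ξ, hξ, e, he, rfl⟩ := ZFSet.mem_prod.1 (hsfun.1 hp)
    exact ZFSet.pair_mem_prod.2 ⟨hord.mem_trans hξ hα, he⟩)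
  have f8 := Fact.mk hf
  let B := ZFSet.sep (fun x => ∃ ξ, ξ ∈ δ ∧ ∃ e, e ∈ S ∧ ∃ η, η ∈ δ ∧
    (ZFSet.pair ξ e ∈ f ∧ ZFSet.pair η x ∈ e)) U
  have hBW : B ∈ W := sep_mem hU _
  have hBU : B ⊆ U := ZFSet.sep_subset
  have hB : ∀ {x}, x ∈ B ↔ ∃ ξ e η, ZFSet.pair ξ e ∈ f ∧ ZFSet.pair η x ∈ e := by
    intro x
    refine ⟨fun hx => ?_, ?_⟩
    · obtain ⟨-, ξ, -, e, -, η, -, h1, h2⟩ := ZFSet.mem_sep.1 hx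
      exact ⟨ξ, e, η, h1, h2⟩
    · rintro ⟨ξ, e, η, h1, h2⟩
      have he := isFunc_cod hfun h1
      have hp := ZFSet.pair_mem_prod.1 ((mem_enums.1 he).1 h2)
      exact ZFSet.mem_sep.2 ⟨hp.2, ξ, isFunc_dom hfun h1, e, he, η, hp.1, h1, h2⟩
  -- At stage `α` the union `B` absorbs `C ∈ 𝒞` and `C' ∈ 𝒞'` containing all earlier stages.
  have stage : ∀ α ∈ δ, ∃ C ∈ 𝒞, ∃ C' ∈ 𝒞', A₀ ⊆ C ∧ C ⊆ C' ∧ C' ⊆ B ∧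
      (∀ ξ e η x, ZFSet.pair ξ e ∈ f → ξ ∈ α → ZFSet.pair η x ∈ e → x ∈ C) ∧
      ∀ u v, u ∈ U → v ∈ U → Requests G δ S (restrict f α) u v → u ≠ v →
        ∃ w ∈ C, ¬ (w ∈ u ↔ w ∈ v) := by
    intro α hα
    obtain ⟨y, hαy, hy⟩ := hstep α hα
    obtain ⟨-, hyS, C, hC, C', hC', hA, hCC', hprev, hran, hreq⟩ := pair_mem_rel.1 hy
    refine ⟨C, hC, C', hC', hA, hCC', fun x hx => ?_, fun ξ e η x hξe hξ hηx => ?_,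
      fun u v hu hv => hreq u hu v hv⟩
    · obtain ⟨η, -, hη⟩ := hran x hx
      exact hB.2 ⟨α, y, η, hαy, hη⟩
    · have he := isFunc_cod hfun hξe
      have hp := ZFSet.pair_mem_prod.1 ((mem_enums.1 he).1 hηx)
      exact hprev ξ (isFunc_dom hfun hξe) e he (pair_mem_restrict.2 ⟨hξe, hξ⟩) η hp.1 x hp.2 hηx
  refine ⟨B, hBW, ?_, hBU, ?_, ?_, ?_⟩
  · obtain ⟨C, -, C', -, h1, h2, h3, -⟩ := stage ∅ hreg.empty_mem
    exact fun z hz => h3 (h2 (h1 hz))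
  · exact sizeLE_of_family hG f3.out hreg.1 hU hBW hBU hreg.1 hord (fun _ h => h) hf hfun
      (fun ξ e η x t _ _ ht => (hG.dom ht).2.2) fun x hx => hB.1 hx
  · intro u hu v hv huv
    obtain ⟨ξ, e, η, hξe, hηu⟩ := hB.1 hu
    obtain ⟨ξ', e', η', hξe', hηv⟩ := hB.1 hv
    have hξ := isFunc_dom hfun hξe
    have hξ' := isFunc_dom hfun hξe'
    have he := isFunc_cod hfun hξe
    have he' := isFunc_cod hfun hξe'
    have hη := (ZFSet.pair_mem_prod.1 ((mem_enums.1 he).1 hηu)).1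
    have hη' := (ZFSet.pair_mem_prod.1 ((mem_enums.1 he').1 hηv)).1
    obtain ⟨a, ha, hGa⟩ := hG.total ξ hξ η hη
    obtain ⟨b, hb, hGb⟩ := hG.total ξ' hξ' η' hη'
    obtain ⟨c, hc, hGc⟩ := hG.total a ha b hb
    have hcδ := hreg.succ_mem hc
    have hlt : ∀ ζ ∈ δ, ζ ⊆ c → ζ ∈ insert c c := fun ζ hζ h => by
      rcases ((hord.mem hζ).subset_iff_eq_or_mem (hord.mem hc)).1 h with h | h
      · exact ZFSet.mem_insert_iff.2 (.inl h)
      · exact ZFSet.mem_insert_of_mem _ h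
    have hξc := hlt ξ hξ fun z hz => (hG.le hGc).1 ((hG.le hGa).1 hz)
    have hξc' := hlt ξ' hξ' fun z hz => (hG.le hGc).2 ((hG.le hGb).1 hz)
    obtain ⟨C, -, C', -, -, hCC', hCB, -, hreq⟩ := stage _ hcδ
    -- The request for `u` and `v` is made at stage `c + 1`, which lies beyond the stages `ξ` and
    -- `ξ'` at which they appear, since the pairing function dominates its arguments.
    have hR : Requests G δ S (restrict f (insert c c)) u v := by
      refine ⟨ξ, hξ, η, hη, ξ', hξ', η', hη', a, ha, b, hb, c, hc, hGa, hGb, hGc,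
        ⟨e, he, pair_mem_restrict.2 ⟨hξe, hξc⟩, hηu⟩,
        ⟨e', he', pair_mem_restrict.2 ⟨hξe', hξc'⟩, hηv⟩, fun ζ hζ => ⟨fun h => ?_, ?_⟩⟩
      · obtain ⟨e, he, hζe⟩ := isFunc_total hfun hζ
        exact ⟨e, he, pair_mem_restrict.2 ⟨hζe, h⟩⟩
      · rintro ⟨e, -, h⟩
        exact (pair_mem_restrict.1 h).2
    obtain ⟨w, hw, hwuv⟩ := hreq u v (hBU hu) (hBU hv) hR huv
    exact ⟨w, hCB (hCC' hw), hwuv⟩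
  · rintro a ha ⟨γ, hγ, g, hg, hgfun, hginj⟩
    have f9 := Fact.mk hg
    have f10 := Fact.mk ha
    -- By regularity, `B ∩ a` is already exhausted at some stage `β < δ`.
    obtain ⟨β, hβ, hbd⟩ := hreg.exists_bound hγ (fun ζ β => ∀ x, x ∈ U → ZFSet.pair x ζ ∈ g →
        (∃ ξ, ξ ∈ δ ∧ ∃ e, e ∈ S ∧ ∃ η, η ∈ δ ∧ (ZFSet.pair ξ e ∈ f ∧ ZFSet.pair η x ∈ e)) →
        ∃ ξ, ξ ∈ β ∧ ∃ e, e ∈ S ∧ ∃ η, η ∈ δ ∧ (ZFSet.pair ξ e ∈ f ∧ ZFSet.pair η x ∈ e))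
      (fun ζ hζ => by
        by_cases h : ∃ x ∈ B, ZFSet.pair x ζ ∈ g
        · obtain ⟨x, hx, hxζ⟩ := h
          obtain ⟨-, ξ, hξ, H⟩ := ZFSet.mem_sep.1 hx
          refine ⟨insert ξ ξ, hreg.succ_mem hξ, fun x' _ hx' _ => ?_⟩
          obtain rfl := hginj x' x ζ hx' hxζ
          exact ⟨ξ, ZFSet.mem_insert _ _, H⟩
        · exact ⟨∅, hreg.empty_mem, fun x hx hxζ H =>
            absurd ⟨x, ZFSet.mem_sep.2 ⟨hx, H⟩, hxζ⟩ h⟩)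
      (fun ζ _ β _ β' _ h hs x hx hxζ H => by
        obtain ⟨ξ, hξ, H'⟩ := h x hx hxζ H
        exact ⟨ξ, hs hξ, H'⟩)
    obtain ⟨C, hC, C', hC', -, hCC', hCB, hprev, -⟩ := stage β hβ
    have hsub : B ∩ a ⊆ C := fun x hx => by
      obtain ⟨hxB, hxa⟩ := ZFSet.mem_inter.1 hx
      obtain ⟨ζ, hζ, hxζ⟩ := isFunc_total hgfun hxa
      obtain ⟨hxU, H⟩ := ZFSet.mem_sep.1 hxB
      obtain ⟨ξ, hξ, e, -, η, -, hξe, hηx⟩ := hbd ζ hζ x hxU hxζ H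
      exact hprev ξ e η x hξe hξ hηx
    exact ⟨⟨C, hC, fun z hz => hCB (hCC' hz), hsub⟩, ⟨C', hC', hCB, fun z hz => hCC' (hsub hz)⟩⟩

end Hull
/-! ### The von Neumann hierarchy of a model -/

section Hierarchy

variable {M : Set ZFSet.{u}} [hM : TransModel M]

theorem IsVonNeumannHierarchy.mem_iff_rank_lt {α h : ZFSet.{u}} (hα : α.IsTransitive)
    (hVN : IsVonNeumannHierarchy M α h) {β v z : ZFSet.{u}} (hv : ZFSet.pair β v ∈ h) (hz : z ∈ M) :
    z ∈ v ↔ z.rank < β.rank := by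
  obtain ⟨⟨Y, hY, hfun⟩, hrec⟩ := hVN
  induction β using ZFSet.inductionOn generalizing v z with
  | _ β ih =>
  rw [hrec β v hv z hz, ZFSet.lt_rank_iff]
  have hdom := isFunc_dom hfun hv
  constructor
  · rintro ⟨γ, hγ, w, hw, hzw⟩
    refine ⟨γ, hγ, ZFSet.rank_le_iff.2 fun y hy => ?_⟩
    exact (ih γ hγ hw (mem_of_mem hz hy)).1 (hzw hy)
  · rintro ⟨γ, hγ, hr⟩
    have hγα : γ ∈ insert α α := by
      rcases ZFSet.mem_insert_iff.1 hdom with rfl | h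
      · exact ZFSet.mem_insert_of_mem _ hγ
      · exact ZFSet.mem_insert_of_mem _ (hα.subset_of_mem h hγ)
    obtain ⟨w, -, hw⟩ := isFunc_total hfun hγα
    exact ⟨γ, hγ, w, hw, fun y hy =>
      (ih γ hγ hw (mem_of_mem hz hy)).2 ((ZFSet.rank_lt_of_mem hy).trans_le hr)⟩

/-- Up to the rank of any of its elements, the levels of the cumulative hierarchy of `M` belong to
`M`, and they are given by the rank function of the ambient universe. -/
theorem exists_level {x : ZFSet.{u}} (hx : x ∈ M) {o : Ordinal.{u}} (ho : o ≤ x.rank) :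
    ∃ U ∈ M, ∀ z, z ∈ U ↔ z ∈ M ∧ z.rank < o := by
  obtain ⟨α, hα, hord, h, -, hVN, v, -, hαv, hxv⟩ := hM.zstar.vonNeumann x hx
  have hlt : o < α.rank :=
    ho.trans_lt ((hVN.mem_iff_rank_lt hord.isTransitive hαv hx).1 hxv)
  -- A transitive set has elements of every smaller rank: take one of least rank `≥ o`.
  obtain ⟨γ, ⟨hγ, hoγ⟩, hmin⟩ := ZFSet.mem_wf.has_min {γ | γ ∈ α ∧ o ≤ γ.rank}
    (ZFSet.lt_rank_iff.1 hlt)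
  have hγo : γ.rank = o := by
    refine le_antisymm (le_of_not_gt fun hlt => ?_) hoγ
    obtain ⟨γ', hγ', h'⟩ := ZFSet.lt_rank_iff.1 hlt
    exact hmin γ' ⟨hord.mem_trans hγ' hγ, h'⟩ hγ'
  obtain ⟨⟨Y, hY, hfun⟩, -⟩ := id hVN
  obtain ⟨U, hUY, hU⟩ := isFunc_total hfun (ZFSet.mem_insert_of_mem α hγ)
  have hUM := mem_of_mem hY hUY
  refine ⟨U, hUM, fun z => ?_⟩
  rw [← hγo]
  exact ⟨fun hz => ⟨mem_of_mem hUM hz,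
      (hVN.mem_iff_rank_lt hord.isTransitive hU (mem_of_mem hUM hz)).1 hz⟩,
    fun ⟨hzM, hz⟩ => (hVN.mem_iff_rank_lt hord.isTransitive hU hzM).2 hz⟩

end Hierarchy

/-! ### Coding extensional sets by subsets of the cardinal -/

section Coding

variable {V V' W : Set ZFSet.{u}} [hV : TransModel V] [hV' : TransModel V'] [hW : TransModel W]
variable {δ U B : ZFSet.{u}}

theorem rel_congr {A B : ZFSet.{u}} {P Q : ZFSet.{u} → ZFSet.{u} → Prop}
    (h : ∀ a ∈ A, ∀ b ∈ B, (P a b ↔ Q a b)) : rel A B P = rel A B Q := by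
  unfold rel
  ext p
  simp only [ZFSet.mem_sep]
  grind

omit hV hW in
theorem SizeLT.mono {a : ZFSet.{u}} (h : V ⊆ W) (ha : SizeLT V a δ) : SizeLT W a δ := by
  obtain ⟨α, hα, f, hf, H⟩ := ha
  exact ⟨α, hα, f, h hf, H⟩

omit hV in
theorem SizeLT.subset {X Y : ZFSet.{u}} (hδ : δ ∈ W) (hX : X ∈ W) (hXY : X ⊆ Y)
    (hY : SizeLT W Y δ) : SizeLT W X δ := by
  obtain ⟨α, hα, f, hf, hfun, hinj⟩ := hY
  have := Fact.mk hf
  refine ⟨α, hα, rel X α fun x ξ => ZFSet.pair x ξ ∈ f,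
    rel_mem hX (mem_of_mem hδ hα) _, isFunc_rel (fun x hx => isFunc_total hfun (hXY hx))
      fun x _ y _ z _ h h' => isFunc_unique hfun h h', fun x y z h h' => ?_⟩
  exact hinj x y z (pair_mem_rel.1 h).2.2 (pair_mem_rel.1 h').2.2

/-- The collapse of an extensional set is injective on it. -/
theorem collapse_injOn (hext : ∀ u ∈ B, ∀ v ∈ B, u ≠ v → ∃ w ∈ B, ¬ (w ∈ u ↔ w ∈ v))
    {b : ZFSet.{u}} (hb : b ∈ B) {c : ZFSet.{u}} (hc : c ∈ B)
    (h : collapse B ZFSet.mem_wf b = collapse B ZFSet.mem_wf c) : b = c := by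
  induction b using ZFSet.inductionOn generalizing c with
  | _ b ih =>
  by_contra hne
  obtain ⟨w, hw, hwbc⟩ := hext b hb c hc hne
  by_cases hwb : w ∈ b
  · have : collapse B ZFSet.mem_wf w ∈ collapse B ZFSet.mem_wf c :=
      h ▸ mem_collapse.2 ⟨w, hw, hwb, rfl⟩
    obtain ⟨d, hd, hdc, hdw⟩ := mem_collapse.1 this
    obtain rfl := ih w hwb hw hd hdw.symm
    exact hwbc (iff_of_true hwb hdc)
  · have hwc : w ∈ c := by tauto
    have : collapse B ZFSet.mem_wf w ∈ collapse B ZFSet.mem_wf b :=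
      h ▸ mem_collapse.2 ⟨w, hw, hwc, rfl⟩
    obtain ⟨d, hd, hdb, hdw⟩ := mem_collapse.1 this
    obtain rfl := ih d hdb hd hw hdw
    exact hwb hdb

theorem rank_collapse_le (b : ZFSet.{u}) :
    (collapse B ZFSet.mem_wf b).rank ≤ b.rank := by
  induction b using ZFSet.inductionOn with
  | _ b ih =>
  refine ZFSet.rank_le_iff.2 fun y hy => ?_
  obtain ⟨c, -, hcb, rfl⟩ := mem_collapse.1 hy
  exact (ih c hcb).trans_lt (ZFSet.rank_lt_of_mem hcb)

omit hV' hW in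
/-- The collapse of a set contained in a level of the hierarchy belongs to the model. -/
theorem exists_collapse_level {o : Ordinal.{u}} (hU : U ∈ V)
    (hUV : ∀ z, z ∈ U ↔ z ∈ V ∧ z.rank < o) (hB : B ∈ V) (hBU : B ⊆ U) :
    ∃ Φ ∈ V, Φ ⊆ ZFSet.prod B U ∧
      ∀ b t, ZFSet.pair b t ∈ Φ ↔ b ∈ B ∧ t = collapse B ZFSet.mem_wf b :=
  exists_collapse_mem hB hU ZFSet.mem_wf (fun _ _ _ => mem_collapse) fun b hb h =>
    (hUV _).2 ⟨h, (rank_collapse_le b).trans_lt ((hUV b).1 (hBU hb)).2⟩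

/-- An extensional set `B` common to `V` and `V'` whose size in `W` is at most `δ` has an injection
into `δ` common to `V` and `V'`. Indeed, its transitive collapse `T` lies in `V` and has hereditary
size at most `δ` in `W`, hence in `V`. An injection of `T` into `δ` in `V` turns membership on `B`
into a relation on a subset of `δ`, which is coded by a subset of `δ` and therefore lies in `V'`; in
`V'`, the collapses of this relation and of `B` agree, which recovers the injection. -/
theorem exists_common_injection {o : Ordinal.{u}} (hreg : IsRegularIn W δ) (hVW : V ⊆ W)
    (hV'W : V' ⊆ W) (hδV : δ ∈ V) (hδV' : δ ∈ V')
    (hpow : powersetIn V δ = powersetIn V' δ)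
    (hH : hereditarilySizeLE W δ ∩ V = hereditarilySizeLE V δ)
    (hU : U ∈ V) (hU' : U ∈ V') (hUV : ∀ z, z ∈ U ↔ z ∈ V ∧ z.rank < o)
    (hUV' : ∀ z, z ∈ U ↔ z ∈ V' ∧ z.rank < o) (hB : B ∈ V) (hB' : B ∈ V') (hBU : B ⊆ U)
    (hBδ : SizeLE W B δ) (hext : ∀ u ∈ B, ∀ v ∈ B, u ≠ v → ∃ w ∈ B, ¬ (w ∈ u ↔ w ∈ v)) :
    ∃ i, i ∈ V ∧ i ∈ V' ∧ ZFSet.IsFunc B δ i ∧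
      ∀ x y z, ZFSet.pair x z ∈ i → ZFSet.pair y z ∈ i → x = y := by
  have hpow' : ∀ x, x ⊆ δ → x ∈ V → x ∈ V' := fun x hx h =>
    ((Set.ext_iff.1 hpow x).1 ⟨h, hx⟩).1
  set π := collapse B ZFSet.mem_wf with hπ
  have hinj : ∀ {b c}, b ∈ B → c ∈ B → π b = π c → b = c := fun hb hc h =>
    collapse_injOn hext hb hc h
  obtain ⟨Φ, hΦ, hΦs, hΦπ⟩ := exists_collapse_level hU hUV hB hBU
  obtain ⟨Φ', hΦ', -, hΦπ'⟩ := exists_collapse_level hU' hUV' hB' hBU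
  rw [← hπ] at hΦπ hΦπ'
  have hπU : ∀ {b}, b ∈ B → π b ∈ U := fun {b} hb =>
    (ZFSet.pair_mem_prod.1 (hΦs ((hΦπ b _).2 ⟨hb, rfl⟩))).2
  have regV := hreg.mono hVW hδV
  have regV' := hreg.mono hV'W hδV'
  have hG := isPairing_godelPairing hreg
  have f1 := Fact.mk hδV
  have f2 := Fact.mk hδV'
  have f3 := Fact.mk hU
  have f4 := Fact.mk hU'
  have f5 := Fact.mk hB
  have f6 := Fact.mk hB'
  have f7 := Fact.mk hΦ
  have f8 := Fact.mk hΦ'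
  have f9 := Fact.mk (hVW hΦ)
  have f10 := Fact.mk (hVW hB)
  have f11 := Fact.mk (godelPairing_mem regV)
  have f12 := Fact.mk (godelPairing_mem regV')
  let T := ZFSet.sep (fun t => ∃ b, b ∈ B ∧ ZFSet.pair b t ∈ Φ) U
  have hT : T ∈ V := sep_mem hU _
  have memT : ∀ {t}, t ∈ T ↔ ∃ b ∈ B, t = π b := by
    intro t
    rw [ZFSet.mem_sep]
    constructor
    · rintro ⟨-, b, hb, h⟩
      exact ⟨b, hb, ((hΦπ _ _).1 h).2⟩
    · rintro ⟨b, hb, rfl⟩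
      exact ⟨hπU hb, b, hb, (hΦπ _ _).2 ⟨hb, rfl⟩⟩
  have hTtr : T.IsTransitive := by
    intro t ht s hs
    obtain ⟨b, hb, rfl⟩ := memT.1 ht
    obtain ⟨c, hc, -, rfl⟩ := mem_collapse.1 hs
    exact memT.2 ⟨c, hc, rfl⟩
  have hTW : SizeLE W T δ := by
    obtain ⟨k, hk, hkfun, hkinj⟩ := hBδ
    have := Fact.mk hk
    refine ⟨rel T δ fun t ξ => ∃ b, b ∈ B ∧ (ZFSet.pair b t ∈ Φ ∧ ZFSet.pair b ξ ∈ k),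
      rel_mem (hVW hT) hreg.1 _, isFunc_rel (fun t ht => ?_) ?_, fun t t' ξ h h' => ?_⟩
    · obtain ⟨b, hb, rfl⟩ := memT.1 ht
      obtain ⟨ξ, hξ, h⟩ := isFunc_total hkfun hb
      exact ⟨ξ, hξ, b, hb, (hΦπ _ _).2 ⟨hb, rfl⟩, h⟩
    · rintro t - ξ - ξ' - ⟨b, hb, hbt, hbξ⟩ ⟨b', hb', hbt', hbξ'⟩
      obtain rfl := hinj hb hb' (((hΦπ _ _).1 hbt).2.symm.trans ((hΦπ _ _).1 hbt').2)
      exact isFunc_unique hkfun hbξ hbξ'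
    · obtain ⟨-, -, b, hb, hbt, hbξ⟩ := pair_mem_rel.1 h
      obtain ⟨-, -, b', hb', hbt', hbξ'⟩ := pair_mem_rel.1 h'
      obtain rfl := hkinj _ _ _ hbξ hbξ'
      exact ((hΦπ _ _).1 hbt).2.trans ((hΦπ _ _).1 hbt').2.symm
  have hTH : T ∈ hereditarilySizeLE V δ :=
    hH ▸ ⟨⟨hVW hT, T, hVW hT, hTtr, fun _ h => h, hTW⟩, hT⟩
  obtain ⟨-, T', -, -, hTT', g, hg, hgfun, hginj⟩ := hTH
  have f13 := Fact.mk hg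
  obtain ⟨i, hidef⟩ : ∃ i, i = rel B δ fun b ξ => ∃ t, t ∈ U ∧
    (ZFSet.pair b t ∈ Φ ∧ ZFSet.pair t ξ ∈ g) := ⟨_, rfl⟩
  have hiV : i ∈ V := hidef ▸ rel_mem hB hδV _
  have f14 := Fact.mk hiV
  have hi : ∀ {b ξ}, ZFSet.pair b ξ ∈ i ↔ b ∈ B ∧ ZFSet.pair (π b) ξ ∈ g := by
    intro b ξ
    rw [hidef, pair_mem_rel]
    constructor
    · rintro ⟨hb, -, t, -, hbt, htξ⟩
      exact ⟨hb, ((hΦπ _ _).1 hbt).2 ▸ htξ⟩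
    · rintro ⟨hb, h⟩
      exact ⟨hb, isFunc_cod hgfun h, π b, hπU hb, (hΦπ _ _).2 ⟨hb, rfl⟩, h⟩
  have hiδ : ∀ {b ξ}, ZFSet.pair b ξ ∈ i → ξ ∈ δ := fun h => isFunc_cod hgfun (hi.1 h).2
  have hiinj : ∀ x y z, ZFSet.pair x z ∈ i → ZFSet.pair y z ∈ i → x = y := fun x y z h h' =>
    hinj (hi.1 h).1 (hi.1 h').1 (hginj _ _ _ (hi.1 h).2 (hi.1 h').2)
  have hifun : ZFSet.IsFunc B δ i := by
    refine ⟨hidef ▸ rel_subset, fun b hb => ?_⟩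
    obtain ⟨ξ, -, h⟩ := isFunc_total hgfun (hTT' (memT.2 ⟨b, hb, rfl⟩))
    exact ⟨ξ, hi.2 ⟨hb, h⟩, fun ξ' h' => isFunc_unique hgfun (hi.1 h').2 h⟩
  refine ⟨i, hiV, ?_, hifun, hiinj⟩
  -- `K` codes the image of membership on `B` under `i`, and `D` is the range of `i`.
  let K := ZFSet.sep (fun t => ∃ ξ, ξ ∈ δ ∧ ∃ η, η ∈ δ ∧
    (ZFSet.pair (ZFSet.pair ξ η) t ∈ godelPairing δ ∧ ∃ b, b ∈ B ∧ ∃ c, c ∈ B ∧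
      (ZFSet.pair b ξ ∈ i ∧ ZFSet.pair c η ∈ i ∧ b ∈ c))) δ
  have hK : K ∈ V' := hpow' K ZFSet.sep_subset (sep_mem hδV _)
  let D := ZFSet.sep (fun ξ => ∃ b, b ∈ B ∧ ZFSet.pair b ξ ∈ i) δ
  have hD : D ∈ V' := hpow' D ZFSet.sep_subset (sep_mem hδV _)
  have memD : ∀ {ξ}, ξ ∈ D ↔ ∃ b, ZFSet.pair b ξ ∈ i := by
    intro ξ
    rw [ZFSet.mem_sep]
    exact ⟨fun ⟨_, b, _, h⟩ => ⟨b, h⟩, fun ⟨b, h⟩ => ⟨hiδ h, b, (hi.1 h).1, h⟩⟩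
  have f15 := Fact.mk hK
  have f16 := Fact.mk hD
  let E : ZFSet.{u} → ZFSet.{u} → Prop := fun ξ η =>
    ∃ t, t ∈ K ∧ ZFSet.pair (ZFSet.pair ξ η) t ∈ godelPairing δ
  have hE : ∀ {ξ η}, E ξ η ↔ ∃ b c, ZFSet.pair b ξ ∈ i ∧ ZFSet.pair c η ∈ i ∧ b ∈ c := by
    intro ξ η
    constructor
    · rintro ⟨t, ht, h⟩
      obtain ⟨-, ξ', -, η', -, h', b, -, c, -, H⟩ := ZFSet.mem_sep.1 ht
      obtain ⟨rfl, rfl⟩ := hG.inj h h'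
      exact ⟨b, c, H⟩
    · rintro ⟨b, c, hb, hc, hbc⟩
      obtain ⟨t, ht, h⟩ := hG.total ξ (hiδ hb) η (hiδ hc)
      exact ⟨t, ZFSet.mem_sep.2 ⟨ht, ξ, hiδ hb, η, hiδ hc, h, b, (hi.1 hb).1, c, (hi.1 hc).1,
        hb, hc, hbc⟩, h⟩
  obtain ⟨j, hj⟩ : ∃ j : ZFSet.{u} → ZFSet.{u}, ∀ b ξ, ZFSet.pair b ξ ∈ i → j ξ = b := by
    classical
    refine ⟨fun ξ => if h : ∃ b, ZFSet.pair b ξ ∈ i then h.choose else ∅, fun b ξ h => ?_⟩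
    have hex : ∃ b, ZFSet.pair b ξ ∈ i := ⟨b, h⟩
    beta_reduce
    rw [dif_pos hex]
    exact hiinj _ _ _ hex.choose_spec h
  have hEwf : WellFounded E := by
    refine Subrelation.wf (fun {ξ η} h => ?_) (InvImage.wf j ZFSet.mem_wf)
    obtain ⟨b, c, hb, hc, hbc⟩ := hE.1 h
    show j ξ ∈ j η
    rwa [hj b ξ hb, hj c η hc]
  have hEdef : DefPred V' fun w : Fin 2 → V' => E (w 0) (w 1) := by
    dsimp only [E]
    infer_instance
  obtain ⟨Ψ, hΨ, -, hΨF⟩ := exists_collapse_mem (F := fun ξ => π (j ξ)) hD hU' hEwf (fun η hη y => by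
      obtain ⟨c, hc⟩ := memD.1 hη
      rw [hj c η hc, hπ, mem_collapse]
      constructor
      · rintro ⟨b, hb, hbc, rfl⟩
        obtain ⟨ξ, -, hξ⟩ := isFunc_total hifun hb
        exact ⟨ξ, memD.2 ⟨b, hξ⟩, hE.2 ⟨b, c, hξ, hc, hbc⟩, by rw [hj b ξ hξ]⟩
      · rintro ⟨ξ, -, hξη, rfl⟩
        obtain ⟨b, c', hb, hc', hbc⟩ := hE.1 hξη
        obtain rfl := hiinj _ _ _ hc hc'
        exact ⟨b, (hi.1 hb).1, hbc, by rw [hj b ξ hb]⟩)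
    (fun η hη _ => by
      obtain ⟨c, hc⟩ := memD.1 hη
      rw [hj c η hc]
      exact hπU (hi.1 hc).1)
  have f17 := Fact.mk hΨ
  have hieq : i = rel B δ fun b ξ => ∃ t, t ∈ U ∧ (ZFSet.pair b t ∈ Φ' ∧ ZFSet.pair ξ t ∈ Ψ) := by
    rw [hidef]
    refine rel_congr fun b hb ξ hξ => ?_
    have : (∃ t, t ∈ U ∧ (ZFSet.pair b t ∈ Φ ∧ ZFSet.pair t ξ ∈ g)) ↔ ZFSet.pair b ξ ∈ i := by
      rw [hidef, pair_mem_rel]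
      exact ⟨fun h => ⟨hb, hξ, h⟩, fun h => h.2.2⟩
    rw [this]
    constructor
    · intro h
      exact ⟨π b, hπU hb, (hΦπ' _ _).2 ⟨hb, rfl⟩, (hΨF _ _).2 ⟨memD.2 ⟨b, h⟩, by rw [hj b ξ h]⟩⟩
    · rintro ⟨t, -, hbt, hξt⟩
      obtain ⟨hξD, hξt⟩ := (hΨF _ _).1 hξt
      obtain ⟨c, hc⟩ := memD.1 hξD
      rw [hj c ξ hc] at hξt
      obtain rfl := hinj hb (hi.1 hc).1 (((hΦπ' _ _).1 hbt).2.symm.trans hξt)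
      exact hc
  rw [hieq]
  exact rel_mem hB' hδV' _

end Coding
/-! ### Uniqueness of the inner model -/

section Uniqueness

variable {V V' W : Set ZFSet.{u}} [hV : TransModel V] [hV' : TransModel V'] [hW : TransModel W]
variable {δ U : ZFSet.{u}}

omit hV' in
/-- The cover property, for subsets of a set `U ∈ V` and with sizes measured in `W`. -/
theorem CoverProperty.exists_subset (hcov : CoverProperty V W δ) (hVW : V ⊆ W) (hδ : δ ∈ W)
    (hU : U ∈ V) {X : ZFSet.{u}} (hX : X ∈ W) (hXU : X ⊆ U) (hXδ : SizeLT W X δ) :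
    ∃ C ∈ pow V U, X ⊆ C ∧ SizeLT W C δ := by
  obtain ⟨C, hC, hXC, hCδ⟩ := hcov X hX (fun x hx => mem_of_mem hU (hXU hx)) hXδ
  have hCU : C ∩ U ∈ V := inter_mem hC hU
  exact ⟨C ∩ U, mem_pow.2 ⟨fun z hz => (ZFSet.mem_inter.1 hz).2, hCU⟩,
    fun z hz => ZFSet.mem_inter.2 ⟨hXC hz, hXU hz⟩,
    (hCδ.mono hVW).subset hδ (hVW hCU) fun z hz => (ZFSet.mem_inter.1 hz).1⟩

omit hW in
/-- A set which is locally a union of members of `P(U)^V` belongs to `V`, by approximation. -/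
theorem ApproximationProperty.mem_of_forall_inter (happ : ApproximationProperty V W δ)
    (hVW : V ⊆ W) (hU : U ∈ V) {B : ZFSet.{u}} (hB : B ∈ W) (hBU : B ⊆ U)
    (h : ∀ a ∈ W, SizeLT W a δ → ∃ C ∈ pow V U, C ⊆ B ∧ B ∩ a ⊆ C) : B ∈ V := by
  refine happ B hB (fun x hx => mem_of_mem hU (hBU hx)) fun a ha haδ => ?_
  obtain ⟨C, hC, hCB, hBC⟩ := h a (hVW ha) (haδ.mono hVW)
  have : B ∩ a = C ∩ a := by
    ext z
    simp only [ZFSet.mem_inter]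
    exact ⟨fun hz => ⟨hBC (ZFSet.mem_inter.2 hz), hz.2⟩, fun hz => ⟨hCB hz.1, hz.2⟩⟩
  rw [this]
  exact inter_mem (mem_pow.1 hC).2 ha

/-- If every small subset of `U` lies in a set common to `V` and `V'` with a common injection into
`δ`, then the subsets of `U` in `V` are in `V'`: their small approximations are coded by subsets
of `δ`. -/
theorem mem_of_subset_of_forall_exists_injection (hVW : V ⊆ W) (hV'W : V' ⊆ W) (hδ : δ ∈ V)
    (hpow : powersetIn V δ = powersetIn V' δ) (happ : ApproximationProperty V' W δ) (hδW : δ ∈ W)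
    (hU' : U ∈ V')
    (hcode : ∀ A ∈ W, A ⊆ U → SizeLT W A δ → ∃ B, B ∈ V ∧ B ∈ V' ∧ A ⊆ B ∧
      ∃ i, i ∈ V ∧ i ∈ V' ∧ ZFSet.IsFunc B δ i ∧
        ∀ x y z, ZFSet.pair x z ∈ i → ZFSet.pair y z ∈ i → x = y)
    {x : ZFSet.{u}} (hx : x ∈ V) (hxU : x ⊆ U) : x ∈ V' := by
  refine happ x (hVW hx) (fun z hz => mem_of_mem hU' (hxU hz)) fun a ha haδ => ?_
  have haU := hV'W (inter_mem ha hU')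
  obtain ⟨B, hB, hB', haB, i, hi, hi', hfun, hinj⟩ := hcode (a ∩ U) haU
    (fun z hz => (ZFSet.mem_inter.1 hz).2)
    ((haδ.mono hV'W).subset hδW haU fun z hz => (ZFSet.mem_inter.1 hz).1)
  have f1 := Fact.mk hx
  have f2 := Fact.mk hB
  have f3 := Fact.mk hi
  have f4 := Fact.mk hi'
  have f5 := Fact.mk ha
  -- `K` is the image of `x ∩ B` under `i`.
  let K := ZFSet.sep (fun ξ => ∃ b, b ∈ B ∧ (b ∈ x ∧ ZFSet.pair b ξ ∈ i)) δ
  have hK : K ∈ V' := ((Set.ext_iff.1 hpow K).1 ⟨sep_mem hδ _, ZFSet.sep_subset⟩).1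
  have f6 := Fact.mk hK
  have : x ∩ a = ZFSet.sep (fun z => z ∈ a ∧ ∃ ξ, ξ ∈ K ∧ ZFSet.pair z ξ ∈ i) B := by
    ext z
    rw [ZFSet.mem_inter, ZFSet.mem_sep]
    constructor
    · rintro ⟨hzx, hza⟩
      have hzB := haB (ZFSet.mem_inter.2 ⟨hza, hxU hzx⟩)
      obtain ⟨ξ, hξ, h⟩ := isFunc_total hfun hzB
      exact ⟨hzB, hza, ξ, ZFSet.mem_sep.2 ⟨hξ, z, hzB, hzx, h⟩, h⟩
    · rintro ⟨hzB, hza, ξ, hξ, h⟩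
      obtain ⟨-, b, -, hbx, hb⟩ := ZFSet.mem_sep.1 hξ
      obtain rfl := hinj _ _ _ h hb
      exact ⟨hbx, hza⟩
  rw [this]
  exact sep_mem hB' _

omit hV hW in
/-- If `V` and `V'` agree below rank `o`, then a level of `V` that belongs to `V` belongs to
`V'`. -/
theorem level_mem (hVW : V ⊆ W) (happ : ApproximationProperty V' W δ) {o : Ordinal.{u}}
    (hlow : ∀ z : ZFSet.{u}, z.rank < o → (z ∈ V ↔ z ∈ V')) (hU : U ∈ V)
    (hUV : ∀ z, z ∈ U ↔ z ∈ V ∧ z.rank < o) : U ∈ V' := by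
  refine happ U (hVW hU) (fun z hz => (hlow z ((hUV z).1 hz).2).1 ((hUV z).1 hz).1)
    fun a ha _ => ?_
  rcases le_or_gt o a.rank with h | h
  · obtain ⟨U', hU', hUV'⟩ := exists_level ha h
    have : U = U' := by
      ext z
      rw [hUV, hUV']
      exact ⟨fun h => ⟨(hlow z h.2).1 h.1, h.2⟩, fun h => ⟨(hlow z h.2).2 h.1, h.2⟩⟩
    rw [this]
    exact inter_mem hU' ha
  · have : U ∩ a = a := by
      ext z
      rw [ZFSet.mem_inter]
      refine ⟨fun h => h.2, fun hz => ⟨?_, hz⟩⟩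
      have hr := (ZFSet.rank_lt_of_mem hz).trans h
      exact (hUV z).2 ⟨(hlow z hr).2 (mem_of_mem ha hz), hr⟩
    rwa [this]

end Uniqueness
end SetModel

open SetModel in
theorem mainTheorem3 (V V' W : Set ZFSet.{u}) (δ : ZFSet.{u})
    (hVtrans : SetModel.IsTransitiveClass V)
    (hV'trans : SetModel.IsTransitiveClass V')
    (hWtrans : SetModel.IsTransitiveClass W)
    (hVZ : SetModel.ModelsZStar V) (hVDC : SetModel.ModelsDC V δ)
    (hV'Z : SetModel.ModelsZStar V') (hV'DC : SetModel.ModelsDC V' δ)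
    (hWZ : SetModel.ModelsZStar W) (hWDC : SetModel.ModelsDC W δ)
    (hδ : SetModel.IsRegularIn W δ)
    (hVW : V ⊆ W) (hV'W : V' ⊆ W)
    (hVcover : SetModel.CoverProperty V W δ)
    (hVapprox : SetModel.ApproximationProperty V W δ)
    (hV'cover : SetModel.CoverProperty V' W δ)
    (hV'approx : SetModel.ApproximationProperty V' W δ)
    (hpow : SetModel.powersetIn V δ = SetModel.powersetIn V' δ)
    (hH : SetModel.hereditarilySizeLE W δ ∩ V = SetModel.hereditarilySizeLE V δ) :
    V = V' := by
  have iV : TransModel V := ⟨hVtrans, hVZ⟩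
  have iV' : TransModel V' := ⟨hV'trans, hV'Z⟩
  have iW : TransModel W := ⟨hWtrans, hWZ⟩
  have hδV := hVDC.1
  have hδV' := hV'DC.1
  suffices H : ∀ o : Ordinal.{u}, ∀ x : ZFSet.{u}, x.rank = o → (x ∈ V ↔ x ∈ V') from
    Set.ext fun x => H _ x rfl
  intro o
  induction o using WellFoundedLT.induction with
  | _ o ih =>
  have hlow : ∀ z : ZFSet.{u}, z.rank < o → (z ∈ V ↔ z ∈ V') := fun z hz => ih _ hz z rfl
  intro x hxo
  -- `U` is the common level of `V` and `V'` below rank `o`; it belongs to both.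
  have step : ∀ U, U ∈ V → U ∈ V' → (∀ z, z ∈ U ↔ z ∈ V ∧ z.rank < o) →
      (x ∈ V ↔ x ∈ V') := by
    intro U hU hU' hUV
    have hUV' : ∀ z, z ∈ U ↔ z ∈ V' ∧ z.rank < o := fun z => by
      rw [hUV]
      exact ⟨fun h => ⟨(hlow z h.2).1 h.1, h.2⟩, fun h => ⟨(hlow z h.2).2 h.1, h.2⟩⟩
    have hUtr : U.IsTransitive := fun y hy z hz => (hUV z).2
      ⟨mem_of_mem ((hUV y).1 hy).1 hz, (ZFSet.rank_lt_of_mem hz).trans ((hUV y).1 hy).2⟩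
    have hcode : ∀ A ∈ W, A ⊆ U → SizeLT W A δ → ∃ B, B ∈ V ∧ B ∈ V' ∧ A ⊆ B ∧
        ∃ i, i ∈ V ∧ i ∈ V' ∧ ZFSet.IsFunc B δ i ∧
          ∀ x y z, ZFSet.pair x z ∈ i → ZFSet.pair y z ∈ i → x = y := by
      intro A hA hAU hAδ
      obtain ⟨B, hBW, hAB, hBU, hBδ, hext, hloc⟩ := exists_hull hδ hWDC (hVW hU) hUtr
        (hVW (pow_mem hU)) (hV'W (pow_mem hU')) (fun C hC => (mem_pow.1 hC).1)
        (fun C hC => (mem_pow.1 hC).1)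
        (fun X hX hXU hXδ => hVcover.exists_subset hVW hδ.1 hU hX hXU hXδ)
        (fun X hX hXU hXδ => hV'cover.exists_subset hV'W hδ.1 hU' hX hXU hXδ) hA hAU hAδ
      have hB := hVapprox.mem_of_forall_inter hVW hU hBW hBU fun a ha haδ => (hloc a ha haδ).1
      have hB' := hV'approx.mem_of_forall_inter hV'W hU' hBW hBU fun a ha haδ => (hloc a ha haδ).2
      exact ⟨B, hB, hB', hAB, exists_common_injection hδ hVW hV'W hδV hδV' hpow hH hU hU' hUV hUV'
        hB hB' hBU hBδ hext⟩
    constructor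
    · intro hx
      exact mem_of_subset_of_forall_exists_injection hVW hV'W hδV hpow hV'approx hδ.1 hU' hcode hx
        fun z hz => (hUV z).2 ⟨mem_of_mem hx hz, hxo ▸ ZFSet.rank_lt_of_mem hz⟩
    · intro hx
      exact mem_of_subset_of_forall_exists_injection hV'W hVW hδV' hpow.symm hVapprox hδ.1 hU
        (fun A hA hAU hAδ => by
          obtain ⟨B, hB, hB', hAB, i, hi, hi', H⟩ := hcode A hA hAU hAδ
          exact ⟨B, hB', hB, hAB, i, hi', hi, H⟩) hx
        fun z hz => (hUV' z).2 ⟨mem_of_mem hx hz, hxo ▸ ZFSet.rank_lt_of_mem hz⟩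
  constructor
  · intro hx
    obtain ⟨U, hU, hUV⟩ := exists_level hx hxo.ge
    exact (step U hU (level_mem hVW hV'approx hlow hU hUV) hUV).1 hx
  · intro hx
    obtain ⟨U, hU', hUV'⟩ := exists_level hx hxo.ge
    have hU := level_mem hV'W hVapprox (fun z hz => (hlow z hz).symm) hU' hUV'
    refine (step U hU hU' fun z => ?_).2 hx
    rw [hUV']
    exact ⟨fun h => ⟨(hlow z h.2).2 h.1, h.2⟩, fun h => ⟨(hlow z h.2).1 h.1, h.2⟩⟩
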